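/- Let $(\Omega,\mathcal F,P,\{\mathcal F_t\}_{t\ge0})$ be a filtered probability space satisfying the usual hypotheses, and let $W$ be a one-dimensional standard Brownian motion relative to $\{\mathcal F_t\}$. Consider $$du+\operatorname{div}_xF(u)\,dt=\sigma(x,u)\,dW(t),\quad t>0,\ x\in\mathbb R^d,\qquad u(0,x)=u_0(x),\tag{1}$$ under the following assumptions. * $F=(F_1,\dots,F_d)\in C^2(\mathbb R;\mathbb R^d)$, and $F,F',F''$ have at most polynomial growth. * There is $C>0$ with $|\sigma(y,v)-\sigma(x,u)|\le C(|u-v|+|x-y|)$ for all $x,y\in\mathbb R^d$ and $u,v\in\mathbb R$. * There is a nonnegative $g\in L^\infty(\mathbb R^d)\cap L^2(\mathbb R^d)$ with $|\sigma(x,u)|\le g(x)(1+|u|)$ for all $x,u$. * $u_0$ is an $\mathcal F_0$-measurable $L^2(\mathbb R^d)$-valued random variable with $E\|u_0\|_{L^p(\mathbb R^d)}^p<\infty$ for $p=2,3,4,\dots$ A convex entropy pair is a pair $(\beta,\zeta)$ with $\beta\in C^2(\mathbb R)$, $\beta\ge0$, $\beta''\ge0$, and $\zeta:\mathbb R\to\mathbb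 R^d$ satisfying $\zeta'=\beta'F'$, where $\beta,\beta',\beta''$ have at most polynomial growth. A stochastic entropy solution of (1) is an $L^2(\mathbb R^d)$-valued $\{\mathcal F_t\}$-predictable process $u(t)=u(t,x)$, $t\ge 0$, such that 1. $\sup_{0\le t\le T}E\|u(t)\|_{L^p(\mathbb R^d)}^p<\infty$ for every $T>0$ and $p=2,3,4,\dots$; 2. for every $0\le\psi\in C_c^{1,2}([0,\infty)\times\mathbb R^d)$, every convex entropy pair $(\beta,\zeta)$ and every $T>0$, almost surely $$\begin{aligned}&\int_{\mathbb R^d}\beta(u_0(x))\psi(0,x)\,dx+\int_0^T\!\!\int_{\mathbb R^d}\beta(u)\,\partial_t\psi\,dx\,dt+\int_0^T\!\!\int_{\mathbb R^d}\zeta(u)\cdot\nabla\psi\,dx\,dt\\&\quad+\frac12\int_0^T\!\!\int_{\mathbb R^d}\sigma^2(x,u)\beta''(u)\psi\,dx\,dt+\int_0^T\!\Big(\int_{\mathbb R^d}\sigma(x,u)\beta'(u)\psi\,dx\Big)\,dW(t)\ \ge\ 0,\end{aligned}$$ where $u=u(t,x)$ and the last integral is an Itô integral. Then every stochastic entropy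 solution $u$ of (1) satisfies, for every nonnegative $\psi\in C_c^2(\mathbb R^d)$ with support $K$, $$\lim_{h\downarrow0}E\Big[\frac1h\int_0^h\int_K|u(t,x)-u_0(x)|\,\psi(x)\,dx\,dt\Big]=0 .$$ -/

import Mathlib

open MeasureTheory ProbabilityTheory Filter Topology Set
open scoped NNReal ENNReal Gradient

namespace StochConsLaw

/-- The Euclidean space `ℝ^d`. -/
abbrev Space (d : ℕ) : Type := EuclideanSpace ℝ (Fin d)

/-- The space `L²(ℝ^d)` (Lebesgue measure). -/
abbrev L2 (d : ℕ) : Type := Lp ℝ 2 (volume : Measure (Space d))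

/-! ### Probabilistic framework -/

/-- Lebesgue measure on the time interval `(0, T]`, as a measure on the time axis `ℝ≥0`. -/
noncomputable def timeMeasure (T : ℝ≥0) : Measure ℝ≥0 :=
  ((volume : Measure ℝ).restrict (Ioc (0 : ℝ) T)).map Real.toNNReal

/-- The usual hypotheses: the filtration is right-continuous, and `𝓕 0` contains every subset of
every `P`-null set (`P s = 0` for an arbitrary set `s` refers to the outer measure). -/
structure UsualHypotheses {Ω : Type*} {mΩ : MeasurableSpace Ω} (𝓕 : Filtration ℝ≥0 mΩ)
    (P : Measure Ω) : Prop where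
  rightContinuous : 𝓕.IsRightContinuous
  complete : ∀ s : Set Ω, P s = 0 → MeasurableSet[𝓕 0] s

/-- `W` is a one-dimensional standard Brownian motion relative to the filtration `𝓕`. -/
structure IsFilteredBrownian {Ω : Type*} {mΩ : MeasurableSpace Ω} (𝓕 : Filtration ℝ≥0 mΩ)
    (P : Measure Ω) (W : ℝ≥0 → Ω → ℝ) : Prop where
  isBrownian : IsBrownianReal W P
  adapted : StronglyAdapted 𝓕 W
  indep : ∀ s t : ℝ≥0, s ≤ t →
    Indep (MeasurableSpace.comap (fun ω ↦ W t ω - W s ω) inferInstance) (𝓕 s) P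

/-! ### The Itô integral -/

/-- A simple (elementary predictable) process `∑ i, ξ i • 1_(s i, t i]`, where `ξ i` is bounded and
`𝓕 (s i)`-measurable. The intervals may overlap. -/
structure SimpleProcess {Ω : Type*} {mΩ : MeasurableSpace Ω} (𝓕 : Filtration ℝ≥0 mΩ) where
  n : ℕ
  left : Fin n → ℝ≥0
  right : Fin n → ℝ≥0
  left_le_right : ∀ i, left i ≤ right i
  coeff : Fin n → Ω → ℝ
  measurable_coeff : ∀ i, StronglyMeasurable[𝓕 (left i)] (coeff i)
  bounded_coeff : ∀ i, ∃ C : ℝ, ∀ ω, |coeff i ω| ≤ C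

/-- The value `∑ i, ξ i ω • 1_(s i, t i](t)` of a simple process. -/
noncomputable def SimpleProcess.eval {Ω : Type*} {mΩ : MeasurableSpace Ω}
    {𝓕 : Filtration ℝ≥0 mΩ} (H : SimpleProcess 𝓕) (t : ℝ≥0) (ω : Ω) : ℝ :=
  ∑ i, (Ioc (H.left i) (H.right i)).indicator (fun _ ↦ H.coeff i ω) t

/-- The stochastic integral `∫_0^T H dW` of a simple process. -/
noncomputable def SimpleProcess.integral {Ω : Type*} {mΩ : MeasurableSpace Ω}
    {𝓕 : Filtration ℝ≥0 mΩ} (H : SimpleProcess 𝓕) (W : ℝ≥0 → Ω → ℝ) (T : ℝ≥0) (ω : Ω) : ℝ :=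
  ∑ i, H.coeff i ω * (W (min (H.right i) T) ω - W (min (H.left i) T) ω)

/-- `I` is (a version of) the Itô integral `∫_0^T f dW`: the process `f` lies in
`L²((0, T] × Ω)`, it is there the limit of simple processes, and `I` is the `L²(Ω)`-limit of the
integrals of these. By the Itô isometry `I` is almost surely determined by `f`. -/
def IsItoIntegral {Ω : Type*} {mΩ : MeasurableSpace Ω} (𝓕 : Filtration ℝ≥0 mΩ)
    (P : Measure Ω) (W : ℝ≥0 → Ω → ℝ) (T : ℝ≥0) (f : ℝ≥0 → Ω → ℝ) (I : Ω → ℝ) : Prop :=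
  MemLp (Function.uncurry f) 2 ((timeMeasure T).prod P) ∧ MemLp I 2 P ∧
    ∃ H : ℕ → SimpleProcess 𝓕,
      Tendsto (fun n ↦ eLpNorm (fun p : ℝ≥0 × Ω ↦ (H n).eval p.1 p.2 - f p.1 p.2) 2
        ((timeMeasure T).prod P)) atTop (𝓝 0) ∧
      Tendsto (fun n ↦ eLpNorm (fun ω ↦ (H n).integral W T ω - I ω) 2 P) atTop (𝓝 0)

open Classical in
/-- The Itô integral `∫_0^T f dW`. It exists for every predictable `f` with
`E ∫_0^T f² dt < ∞`; outside its domain the operator has the default value `0`. -/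
noncomputable def itoIntegral {Ω : Type*} {mΩ : MeasurableSpace Ω} (𝓕 : Filtration ℝ≥0 mΩ)
    (P : Measure Ω) (W : ℝ≥0 → Ω → ℝ) (T : ℝ≥0) (f : ℝ≥0 → Ω → ℝ) : Ω → ℝ :=
  if h : ∃ I, IsItoIntegral 𝓕 P W T f I then h.choose else 0

/-! ### Assumptions on the coefficients -/

/-- At most polynomial growth. -/
def PolyGrowth {E : Type*} [Norm E] (f : ℝ → E) : Prop :=
  ∃ (C : ℝ) (m : ℕ), ∀ s, ‖f s‖ ≤ C * (1 + |s| ^ m)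

/-- The flux is `C²`, and it and its first two derivatives have at most polynomial growth. -/
structure FluxAssumption {d : ℕ} (F : ℝ → Space d) : Prop where
  contDiff : ContDiff ℝ 2 F
  growth : PolyGrowth F
  growth_deriv : PolyGrowth (deriv F)
  growth_deriv2 : PolyGrowth (deriv (deriv F))

/-- The noise coefficient is Lipschitz, and `|σ(x,u)| ≤ g(x) (1 + |u|)` for some nonnegative
`g ∈ L^∞ ∩ L²`. -/
structure NoiseAssumption {d : ℕ} (σ : Space d → ℝ → ℝ) : Prop where
  lipschitz : ∃ C : ℝ, 0 < C ∧ ∀ x y u v, |σ y v - σ x u| ≤ C * (|u - v| + ‖x - y‖)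
  growth : ∃ g : Space d → ℝ, (∀ x, 0 ≤ g x) ∧ MemLp g ∞ volume ∧ MemLp g 2 volume ∧
    ∀ x u, |σ x u| ≤ g x * (1 + |u|)

/-- The initial datum is an `𝓕 0`-measurable `L²(ℝ^d)`-valued random variable with
`E ‖u₀‖_p^p < ∞` for `p = 2, 3, 4, …`. -/
structure InitialAssumption {Ω : Type*} {mΩ : MeasurableSpace Ω} {d : ℕ}
    (𝓕 : Filtration ℝ≥0 mΩ) (P : Measure Ω) (u₀ : Ω → L2 d) : Prop where
  measurable : StronglyMeasurable[𝓕 0] u₀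
  moments : ∀ p : ℕ, 2 ≤ p → ∫⁻ ω, (∫⁻ x, ‖u₀ ω x‖ₑ ^ p) ∂P < ∞

/-! ### Entropy solutions -/

/-- `(β, ζ)` is a convex entropy flux pair for the flux `F`: `β ∈ C²`, `β ≥ 0`, `β'' ≥ 0` and
`ζ' = β' F'`. At most polynomial growth of `β`, `β'`, `β''` makes all terms of the entropy
inequality well defined. -/
structure IsConvexEntropyPair {d : ℕ} (F : ℝ → Space d) (β : ℝ → ℝ) (ζ : ℝ → Space d) :
    Prop where
  contDiff : ContDiff ℝ 2 β
  nonneg : ∀ r, 0 ≤ β r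
  convex : ∀ r, 0 ≤ deriv (deriv β) r
  flux : ∀ r, HasDerivAt ζ (deriv β r • deriv F r) r
  growth : PolyGrowth β
  growth_deriv : PolyGrowth (deriv β)
  growth_deriv2 : PolyGrowth (deriv (deriv β))

/-- Nonnegative test functions of class `C_c^{1,2}([0,∞) × ℝ^d)`. Such a function is the
restriction to `t ≥ 0` of a `C^{1,2}` function with compact support on `ℝ × ℝ^d`, which is how it
is represented here; the sign condition concerns `t ≥ 0` only. -/
structure IsTestFunction {d : ℕ} (ψ : ℝ → Space d → ℝ) : Prop where
  hasCompactSupport : HasCompactSupport (Function.uncurry ψ)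
  continuous : Continuous (Function.uncurry ψ)
  contDiff_time : ∀ x, ContDiff ℝ 1 (fun t ↦ ψ t x)
  continuous_deriv_time : Continuous (fun p : ℝ × Space d ↦ deriv (fun t ↦ ψ t p.2) p.1)
  contDiff_space : ∀ t, ContDiff ℝ 2 (ψ t)
  continuous_fderiv : Continuous (fun p : ℝ × Space d ↦ fderiv ℝ (ψ p.1) p.2)
  continuous_fderiv2 : Continuous (fun p : ℝ × Space d ↦ fderiv ℝ (fderiv ℝ (ψ p.1)) p.2)
  nonneg : ∀ t, 0 ≤ t → ∀ x, 0 ≤ ψ t x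

/-- The integrand `t ↦ ∫ σ(x, u(t,x)) β'(u(t,x)) ψ(t,x) dx` of the stochastic term. -/
noncomputable def noiseIntegrand {Ω : Type*} {d : ℕ} (σ : Space d → ℝ → ℝ)
    (u : ℝ≥0 → Ω → L2 d) (β : ℝ → ℝ) (ψ : ℝ → Space d → ℝ) (t : ℝ≥0) (ω : Ω) : ℝ :=
  ∫ x, σ x (u t ω x) * deriv β (u t ω x) * ψ t x

/-- The left-hand side of the entropy inequality on `(0, T] × ℝ^d`. -/
noncomputable def entropyFunctional {Ω : Type*} {mΩ : MeasurableSpace Ω} {d : ℕ}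
    (𝓕 : Filtration ℝ≥0 mΩ) (P : Measure Ω) (W : ℝ≥0 → Ω → ℝ) (σ : Space d → ℝ → ℝ)
    (u₀ : Ω → L2 d) (u : ℝ≥0 → Ω → L2 d) (β : ℝ → ℝ) (ζ : ℝ → Space d)
    (ψ : ℝ → Space d → ℝ) (T : ℝ≥0) (ω : Ω) : ℝ :=
  (∫ x, β (u₀ ω x) * ψ 0 x)
    + (∫ t, (∫ x, β (u t ω x) * deriv (fun s ↦ ψ s x) t) ∂timeMeasure T)
    + (∫ t, (∫ x, inner ℝ (ζ (u t ω x)) (∇ (ψ t) x)) ∂timeMeasure T)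
    + 1 / 2 * (∫ t, (∫ x, σ x (u t ω x) ^ 2 * deriv (deriv β) (u t ω x) * ψ t x) ∂timeMeasure T)
    + itoIntegral 𝓕 P W T (noiseIntegrand σ u β ψ) ω

/-- Stochastic entropy solutions of `du + div F(u) dt = σ(x,u) dW`, `u(0) = u₀`. -/
structure IsStochasticEntropySolution {Ω : Type*} {mΩ : MeasurableSpace Ω} {d : ℕ}
    (𝓕 : Filtration ℝ≥0 mΩ) (P : Measure Ω) (W : ℝ≥0 → Ω → ℝ) (F : ℝ → Space d)
    (σ : Space d → ℝ → ℝ) (u₀ : Ω → L2 d) (u : ℝ≥0 → Ω → L2 d) : Prop where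
  predictable : IsStronglyPredictable 𝓕 u
  moments : ∀ T : ℝ≥0, 0 < T → ∀ p : ℕ, 2 ≤ p →
    (⨆ t ∈ Icc 0 T, ∫⁻ ω, (∫⁻ x, ‖u t ω x‖ₑ ^ p) ∂P) < ∞
  entropy : ∀ ψ : ℝ → Space d → ℝ, IsTestFunction ψ →
    ∀ (β : ℝ → ℝ) (ζ : ℝ → Space d), IsConvexEntropyPair F β ζ → ∀ T : ℝ≥0, 0 < T →
      ∀ᵐ ω ∂P, 0 ≤ entropyFunctional 𝓕 P W σ u₀ u β ζ ψ T ω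

end StochConsLaw

namespace StochConsLaw

/-! ### Time averages -/

/-! The entropy inequality is one-sided, and `β r = ± r` is not admissible because `β ≥ 0` is
required. The shifted squares `β r = (r - a) ^ 2`, with `a` ranging over all reals, make up for
this.

Take the test function `θ(t) φ(x)` with `θ(t) = (1 - t / h)²` on `[0, h]`, and `T = h`. The term
with `∂ₜψ` becomes minus an average of `∫ (u(t) - a)² φ` over `(0, h]` against the probability
density `-θ'`. The flux and Itô-correction terms have expectation `O(h)` by the moment bounds, and
the stochastic integral has mean zero even after multiplication by a bounded `𝓕 0`-measurable weight
`χ`. Hence (`exists_averaged_entropy_bound`) the averaged `E[χ ∫ (u - a)² φ]` exceeds `E[χ ∫ (u₀ -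
a)² φ]` by at most `C_a h`.

Expanding the squares with `χ = 1_A` gives `Y(h) - 2 a X(h) ≤ C_a h`, where `X` is the averaged
`E[1_A ∫ (u - u₀) φ]` and `Y` is bounded below independently of `a`. Letting `a` be large of either
sign forces `X → 0` (`tendsto_zero_of_quadratic_bound`). By density, `u - u₀` tends weakly to zero
on average against every `𝓕 0`-measurable `g ∈ L²(Ω; L²)` (`tendsto_avgPairing_deviation`).

Weak convergence becomes strong through `∫ (u - u₀)² φ = ∫ u² φ - ∫ u₀² φ - 2 ∫ (u - u₀) u₀ φ`. The
difference of the first two terms is at most `O(h)` on average, by the case `a = 0`; the last tends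
to zero by weak convergence with `g = φ u₀`, which is `𝓕 0`-measurable
(`tendsto_quadEntropy_deviation`). Young's inequality then passes from weighted `L²` to weighted
`L¹`. -/

lemma ae_timeMeasure_mem (T : ℝ≥0) : ∀ᵐ t ∂timeMeasure T, 0 < t ∧ t ≤ T := by
  rw [timeMeasure, ae_map_iff (by fun_prop) (measurableSet_Ioc (a := (0 : ℝ≥0)) (b := T))]
  filter_upwards [ae_restrict_mem measurableSet_Ioc] with t ht
  exact ⟨Real.toNNReal_pos.2 ht.1, by simpa using Real.toNNReal_le_toNNReal ht.2⟩

lemma lintegral_timeMeasure {T : ℝ≥0} {f : ℝ≥0 → ℝ≥0∞} (hf : Measurable f) :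
    ∫⁻ t, f t ∂timeMeasure T = ∫⁻ t in Ioc (0 : ℝ) T, f t.toNNReal := by
  rw [timeMeasure, lintegral_map hf (by fun_prop)]

lemma timeMeasure_univ (T : ℝ≥0) : timeMeasure T univ = T := by
  rw [timeMeasure, Measure.map_apply (by fun_prop) MeasurableSet.univ]
  simp

instance (T : ℝ≥0) : IsFiniteMeasure (timeMeasure T) :=
  ⟨by rw [timeMeasure_univ]; exact ENNReal.coe_lt_top⟩

lemma timeMeasure_mono {S T : ℝ≥0} (h : S ≤ T) : timeMeasure S ≤ timeMeasure T :=
  Measure.map_mono (Measure.restrict_mono (Ioc_subset_Ioc_right (by exact_mod_cast h)) le_rfl)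
    (by fun_prop)

/-- The density `-θ'` for the time cutoff `θ(t) = (1 - t / h)²`. -/
noncomputable def timeWeight (h t : ℝ≥0) : ℝ := 2 / h * (1 - t / h)

@[fun_prop]
lemma continuous_timeWeight (h : ℝ≥0) : Continuous (timeWeight h) := by
  unfold timeWeight; fun_prop

lemma timeWeight_nonneg {h t : ℝ≥0} (ht : t ≤ h) : 0 ≤ timeWeight h t := by
  have : (t : ℝ) / h ≤ 1 := div_le_one_of_le₀ (by exact_mod_cast ht) (by positivity)
  exact mul_nonneg (by positivity) (by linarith)

/-- The measure `-θ'(t) dt` on `(0, h]` for the time cutoff `θ(t) = (1 - t / h)²`. -/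
noncomputable def weightedTime (h : ℝ≥0) : Measure ℝ≥0 :=
  (timeMeasure h).withDensity fun t ↦ ENNReal.ofReal (timeWeight h t)

/-- The total mass is `θ(0) - θ(h) = 1`. -/
lemma isProbabilityMeasure_weightedTime {h : ℝ≥0} (hh : 0 < h) :
    IsProbabilityMeasure (weightedTime h) := by
  have hh' : (0 : ℝ) < h := by exact_mod_cast hh
  refine ⟨?_⟩
  rw [weightedTime, withDensity_apply _ MeasurableSet.univ, Measure.restrict_univ,
    lintegral_timeMeasure (by fun_prop)]
  have hc : Continuous fun t : ℝ ↦ 2 / (h : ℝ) * (1 - t / h) := by fun_prop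
  have e : ∫⁻ t in Ioc (0 : ℝ) h, ENNReal.ofReal (timeWeight h t.toNNReal)
      = ∫⁻ t in Ioc (0 : ℝ) h, ENNReal.ofReal (2 / (h : ℝ) * (1 - t / h)) := by
    refine setLIntegral_congr_fun measurableSet_Ioc fun t ht ↦ ?_
    simp only [timeWeight, Real.coe_toNNReal _ ht.1.le]
  rw [e, ← ofReal_integral_eq_lintegral_ofReal]
  · rw [← intervalIntegral.integral_of_le hh'.le]
    have : ∫ t in (0 : ℝ)..h, 2 / (h : ℝ) * (1 - t / h) = 1 := by
      simp only [intervalIntegral.integral_const_mul]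
      rw [intervalIntegral.integral_sub (by simp) (by
        exact (by fun_prop : Continuous fun t : ℝ ↦ t / (h : ℝ)).intervalIntegrable _ _)]
      simp
      field_simp
      ring
    simp [this]
  · exact (hc.intervalIntegrable 0 h).1
  · filter_upwards [ae_restrict_mem measurableSet_Ioc] with t ht
    have : t / h ≤ 1 := div_le_one_of_le₀ ht.2 hh'.le
    exact mul_nonneg (by positivity) (by linarith)

lemma weightedTime_absolutelyContinuous (h : ℝ≥0) : weightedTime h ≪ timeMeasure h :=
  withDensity_absolutelyContinuous _ _

instance (h : ℝ≥0) : SFinite (weightedTime h) := by unfold weightedTime; infer_instance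

lemma ae_weightedTime_mem (h : ℝ≥0) : ∀ᵐ t ∂weightedTime h, 0 < t ∧ t ≤ h :=
  (weightedTime_absolutelyContinuous h).ae_le (ae_timeMeasure_mem h)

lemma integral_weightedTime (h : ℝ≥0) (f : ℝ≥0 → ℝ) :
    ∫ t, f t ∂weightedTime h = ∫ t, timeWeight h t * f t ∂timeMeasure h := by
  rw [weightedTime, integral_withDensity_eq_integral_toReal_smul (by fun_prop) (by simp)]
  refine integral_congr_ae ?_
  filter_upwards [ae_timeMeasure_mem h] with t ht
  simp [ENNReal.toReal_ofReal (timeWeight_nonneg ht.2)]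

/-- Averaging over `(0, h]` is dominated by averaging against `weightedTime (2 * h)`. -/
lemma inv_mul_lintegral_timeMeasure_le {h : ℝ≥0} (hh : 0 < h) {f : ℝ≥0 → ℝ≥0∞}
    (hf : Measurable f) :
    (h : ℝ≥0∞)⁻¹ * ∫⁻ t, f t ∂timeMeasure h ≤ 2 * ∫⁻ t, f t ∂weightedTime (2 * h) := by
  have hh' : (0 : ℝ) < h := by exact_mod_cast hh
  rw [weightedTime, lintegral_withDensity_eq_lintegral_mul _ (by fun_prop) hf,
    ← lintegral_const_mul _ hf, ← lintegral_const_mul _ (by fun_prop)]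
  calc ∫⁻ t, (h : ℝ≥0∞)⁻¹ * f t ∂timeMeasure h
      ≤ ∫⁻ t, 2 * ((fun t ↦ ENNReal.ofReal (timeWeight (2 * h) t)) * f) t ∂timeMeasure h := by
        refine lintegral_mono_ae ?_
        filter_upwards [ae_timeMeasure_mem h] with t ht
        rw [Pi.mul_apply, ← mul_assoc]
        gcongr
        have ht' : (t : ℝ) ≤ h := by exact_mod_cast ht.2
        have e2 : (2 : ℝ≥0∞) = ENNReal.ofReal 2 := by simp
        rw [e2, ← ENNReal.ofReal_mul (by norm_num), ← ENNReal.ofReal_coe_nnreal,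
          ← ENNReal.ofReal_inv_of_pos hh']
        refine ENNReal.ofReal_le_ofReal ?_
        rw [timeWeight]
        push_cast
        -- The weight for `2 * h` vanishes only at `2 * h`; on the first half `(0, h]` it is at
        -- least `1 / (2 h)`, whence the factor `2`.
        have : (t : ℝ) / (2 * h) ≤ 1 / 2 := by
          rw [div_le_div_iff₀ (by positivity) (by norm_num)]; linarith
        calc (h : ℝ)⁻¹ = 2 * (2 / (2 * h) * (1 - 1 / 2)) := by field_simp; norm_num
          _ ≤ _ := by gcongr
    _ ≤ _ := lintegral_mono' (timeMeasure_mono (by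
        calc h = 1 * h := (one_mul h).symm
          _ ≤ 2 * h := by gcongr; norm_num)) le_rfl

/-! ### Functionals on `L²` -/

variable {d : ℕ}

/-- The functional `v ↦ ∫ |v|^p` with values in `[0, ∞]`. -/
noncomputable def powerMoment (p : ℕ) (v : L2 d) : ℝ≥0∞ := ∫⁻ x, ‖v x‖ₑ ^ p

/-- Fatou's lemma along an a.e. convergent subsequence. For `p > 2` the functional can be infinite
and is not continuous on `L²`, but semicontinuity suffices for Borel measurability. -/
lemma lowerSemicontinuous_powerMoment (p : ℕ) :
    LowerSemicontinuous (powerMoment p : L2 d → ℝ≥0∞) := by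
  rw [lowerSemicontinuous_iff_isClosed_preimage]
  intro y
  refine isClosed_of_closure_subset fun v hv ↦ ?_
  obtain ⟨w, hw, hwv⟩ := mem_closure_iff_seq_limit.1 hv
  obtain ⟨ns, -, hns⟩ := (tendstoInMeasure_of_tendsto_Lp hwv).exists_seq_tendsto_ae
  calc powerMoment p v = ∫⁻ x, liminf (fun n ↦ ‖w (ns n) x‖ₑ ^ p) atTop := by
        refine lintegral_congr_ae ?_
        filter_upwards [hns] with x hx
        exact ((((ENNReal.continuous_pow p).comp continuous_enorm).tendsto _).comp hx).liminf_eq.symm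
    _ ≤ liminf (fun n ↦ ∫⁻ x, ‖w (ns n) x‖ₑ ^ p) atTop :=
        lintegral_liminf_le' fun n ↦ ((Lp.aestronglyMeasurable _).enorm.pow_const _)
    _ ≤ y := by
        refine liminf_le_of_frequently_le' (Frequently.of_forall fun n ↦ hw (ns n))

lemma measurable_powerMoment_comp {α : Type*} [MeasurableSpace α] (p : ℕ) {f : α → L2 d}
    (hf : StronglyMeasurable f) : Measurable fun a ↦ powerMoment p (f a) := by
  borelize (L2 d)
  exact (lowerSemicontinuous_powerMoment p).measurable.comp hf.measurable

lemma powerMoment_two (v : L2 d) : powerMoment 2 v = ‖v‖ₑ ^ 2 := by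
  rw [Lp.enorm_def, eLpNorm_eq_lintegral_rpow_enorm_toReal (by simp) (by simp),
    ← ENNReal.rpow_natCast, ← ENNReal.rpow_mul]
  simp [powerMoment]

/-- Multiplication by a continuous compactly supported function on `L²`. -/
noncomputable def mulL (φ : Space d → ℝ) (hφ : Continuous φ) (hc : HasCompactSupport φ) :
    L2 d →L[ℝ] L2 d :=
  (ContinuousLinearMap.mul ℝ ℝ).holderL (volume : Measure (Space d)) ∞ 2 2
    ((hφ.memLp_of_hasCompactSupport hc : MemLp φ ∞ volume).toLp)

lemma mulL_coe (φ : Space d → ℝ) (hφ : Continuous φ) (hc : HasCompactSupport φ) (v : L2 d) :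
    mulL φ hφ hc v =ᵐ[volume] fun x ↦ φ x * v x := by
  have h1 := (ContinuousLinearMap.mul ℝ ℝ).coeFn_holder (r := 2)
    ((hφ.memLp_of_hasCompactSupport hc : MemLp φ ∞ volume).toLp) v
  filter_upwards [h1, (hφ.memLp_of_hasCompactSupport hc : MemLp φ ∞ volume).coeFn_toLp]
    with x hx hx'
  simp [mulL, hx, hx']

/-- A continuous compactly supported function as an element of `L²`. -/
noncomputable def toL2 (φ : Space d → ℝ) (hφ : Continuous φ) (hc : HasCompactSupport φ) : L2 d :=
  (hφ.memLp_of_hasCompactSupport hc : MemLp φ 2 volume).toLp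

lemma toL2_coe (φ : Space d → ℝ) (hφ : Continuous φ) (hc : HasCompactSupport φ) :
    toL2 φ hφ hc =ᵐ[volume] φ := MemLp.coeFn_toLp _

lemma integrable_sq_mul {φ : Space d → ℝ} (hφ : Continuous φ) (hc : HasCompactSupport φ)
    (v : L2 d) : Integrable fun x ↦ v x ^ 2 * φ x := by
  refine (L2.integrable_inner (𝕜 := ℝ) v (mulL φ hφ hc v)).congr ?_
  filter_upwards [mulL_coe φ hφ hc v] with x hx
  simp [hx]; ring

lemma inner_mulL {φ : Space d → ℝ} (hφ : Continuous φ) (hc : HasCompactSupport φ) (v w : L2 d) :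
    inner ℝ v (mulL φ hφ hc w) = ∫ x, v x * w x * φ x := by
  rw [L2.inner_def]
  refine integral_congr_ae ?_
  filter_upwards [mulL_coe φ hφ hc w] with x hx
  simp [hx]; ring

lemma integrable_mul {φ : Space d → ℝ} (hφ : Continuous φ) (hc : HasCompactSupport φ)
    (v : L2 d) : Integrable fun x ↦ v x * φ x := by
  refine (L2.integrable_inner (𝕜 := ℝ) v (toL2 φ hφ hc)).congr ?_
  filter_upwards [toL2_coe φ hφ hc] with x hx
  simp [hx]; ring

lemma inner_toL2 {φ : Space d → ℝ} (hφ : Continuous φ) (hc : HasCompactSupport φ) (v : L2 d) :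
    inner ℝ v (toL2 φ hφ hc) = ∫ x, v x * φ x := by
  rw [L2.inner_def]
  refine integral_congr_ae ?_
  filter_upwards [toL2_coe φ hφ hc] with x hx
  simp [hx]; ring

/-- The quadratic entropy `∫ (v - a)² φ`. -/
noncomputable def quadEntropy (φ : Space d → ℝ) (a : ℝ) (v : L2 d) : ℝ := ∫ x, (v x - a) ^ 2 * φ x

/-- Exhibits the entropy as a bounded quadratic form plus a linear and a constant term. Continuity
and quadratic growth follow, and `a` enters the difference of two entropies only through the linear
term. -/
lemma quadEntropy_eq {φ : Space d → ℝ} (hφ : Continuous φ) (hc : HasCompactSupport φ) (a : ℝ)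
    (v : L2 d) :
    quadEntropy φ a v = inner ℝ v (mulL φ hφ hc v) - 2 * a * inner ℝ v (toL2 φ hφ hc)
      + a ^ 2 * ∫ x, φ x := by
  rw [inner_mulL, inner_toL2, ← integral_const_mul, ← integral_const_mul, ← integral_sub,
    ← integral_add]
  · refine integral_congr_ae (ae_of_all _ fun x ↦ ?_)
    simp only; ring
  · refine Integrable.sub ?_ ((integrable_mul hφ hc v).const_mul _)
    exact (integrable_sq_mul hφ hc v).congr (ae_of_all _ fun x ↦ by simp only; ring)
  · exact (hφ.integrable_of_hasCompactSupport hc).const_mul _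
  · exact (integrable_sq_mul hφ hc v).congr (ae_of_all _ fun x ↦ by simp only; ring)
  · exact (integrable_mul hφ hc v).const_mul _

lemma continuous_quadEntropy {φ : Space d → ℝ} (hφ : Continuous φ) (hc : HasCompactSupport φ)
    (a : ℝ) : Continuous (quadEntropy φ a : L2 d → ℝ) := by
  have : (quadEntropy φ a : L2 d → ℝ) = fun v ↦ inner ℝ v (mulL φ hφ hc v)
      - 2 * a * inner ℝ v (toL2 φ hφ hc) + a ^ 2 * ∫ x, φ x :=
    funext fun v ↦ quadEntropy_eq hφ hc a v
  rw [this]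
  fun_prop

lemma abs_quadEntropy_le {φ : Space d → ℝ} (hφ : Continuous φ) (hc : HasCompactSupport φ)
    (a : ℝ) : ∃ C : ℝ, 0 ≤ C ∧ ∀ v : L2 d, |quadEntropy φ a v| ≤ C * (1 + ‖v‖ ^ 2) := by
  set M := mulL φ hφ hc
  set f := toL2 φ hφ hc
  refine ⟨‖M‖ + |a| * ‖f‖ + a ^ 2 * |∫ x, φ x|, by positivity, fun v ↦ ?_⟩
  rw [quadEntropy_eq hφ hc]
  have h1 : |inner ℝ v (M v)| ≤ ‖M‖ * ‖v‖ ^ 2 := by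
    refine (abs_real_inner_le_norm _ _).trans ?_
    nlinarith [M.le_opNorm v, norm_nonneg v]
  have h2 : |2 * a * inner ℝ v f| ≤ |a| * ‖f‖ * (1 + ‖v‖ ^ 2) := by
    rw [abs_mul, abs_mul, abs_two]
    have h3 := abs_real_inner_le_norm v f
    have h4 : 2 * ‖v‖ ≤ 1 + ‖v‖ ^ 2 := by nlinarith [sq_nonneg (‖v‖ - 1)]
    calc 2 * |a| * |inner ℝ v f| ≤ 2 * |a| * (‖v‖ * ‖f‖) := by gcongr
      _ = |a| * ‖f‖ * (2 * ‖v‖) := by ring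
      _ ≤ _ := by gcongr
  have h3 : |a ^ 2 * ∫ x, φ x| ≤ a ^ 2 * |∫ x, φ x| * (1 + ‖v‖ ^ 2) := by
    rw [abs_mul, abs_of_nonneg (sq_nonneg a)]
    exact le_mul_of_one_le_right (by positivity) (by nlinarith [sq_nonneg ‖v‖])
  calc _ ≤ |inner ℝ v (M v)| + |2 * a * inner ℝ v f| + |a ^ 2 * ∫ x, φ x| :=
        (abs_add_le _ _).trans (add_le_add (abs_sub _ _) le_rfl)
    _ ≤ _ := by nlinarith [norm_nonneg M]

/-! ### Predictability and the Itô integral -/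

section Ito

variable {Ω : Type*} {mΩ : MeasurableSpace Ω} {𝓕 : Filtration ℝ≥0 mΩ} {P : Measure Ω}
  {W : ℝ≥0 → Ω → ℝ}

lemma stronglyMeasurable_uncurry_of_predictable {E : Type*} [TopologicalSpace E]
    {u : ℝ≥0 → Ω → E} (hu : IsStronglyPredictable 𝓕 u) :
    StronglyMeasurable (Function.uncurry u) := by
  refine StronglyMeasurable.mono hu (MeasurableSpace.generateFrom_le ?_)
  rintro - (⟨A, hA, rfl⟩ | ⟨i, A, hA, rfl⟩)
  · exact (measurableSet_singleton _).prod (𝓕.le _ _ hA)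
  · exact measurableSet_Ioi.prod (𝓕.le _ _ hA)

lemma memLp_increment [IsProbabilityMeasure P] (hW : IsFilteredBrownian 𝓕 P W) (s t : ℝ≥0) :
    MemLp (fun ω ↦ W t ω - W s ω) 2 P := by
  have h (r : ℝ≥0) : MemLp (W r) 2 P :=
    (hW.isBrownian.isGaussianProcess.hasGaussianLaw_eval r).memLp_two
  exact (h t).sub (h s)

lemma integral_mul_increment [IsProbabilityMeasure P] (hW : IsFilteredBrownian 𝓕 P W)
    {s t : ℝ≥0} (hst : s ≤ t) {ξ : Ω → ℝ} (hξ : StronglyMeasurable[𝓕 s] ξ) :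
    ∫ ω, ξ ω * (W t ω - W s ω) ∂P = 0 := by
  have hind : IndepFun ξ (fun ω ↦ W t ω - W s ω) P := by
    rw [IndepFun_iff_Indep]
    exact indep_of_indep_of_le_left (hW.indep s t hst).symm hξ.measurable.comap_le
  have h := hind.integral_mul_eq_mul_integral (hξ.mono (𝓕.le s)).aestronglyMeasurable
    (memLp_increment hW s t).aestronglyMeasurable
  simp only [Pi.mul_apply] at h
  rw [h, integral_sub (hW.isBrownian.integrable_eval t) (hW.isBrownian.integrable_eval s),
    hW.isBrownian.integral_eval, hW.isBrownian.integral_eval]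
  simp

lemma memLp_simpleIntegral [IsProbabilityMeasure P] (hW : IsFilteredBrownian 𝓕 P W)
    (H : SimpleProcess 𝓕) (T : ℝ≥0) : MemLp (H.integral W T) 2 P := by
  refine memLp_finsetSum _ fun i _ ↦ ?_
  obtain ⟨C, hC⟩ := H.bounded_coeff i
  exact (memLp_increment hW _ _).mul (memLp_top_of_bound
    ((H.measurable_coeff i).mono (𝓕.le _)).aestronglyMeasurable C (ae_of_all _ hC))

/-- The weight is known at time zero, so it can be absorbed into each coefficient, which stays
measurable at the left endpoint and hence independent of the increment that follows. -/
lemma integral_mul_simpleIntegral [IsProbabilityMeasure P] (hW : IsFilteredBrownian 𝓕 P W)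
    (H : SimpleProcess 𝓕) (T : ℝ≥0) {χ : Ω → ℝ} (hχ : StronglyMeasurable[𝓕 0] χ) {B : ℝ}
    (hB : ∀ ω, |χ ω| ≤ B) : ∫ ω, χ ω * H.integral W T ω ∂P = 0 := by
  have hχ2 : MemLp χ ∞ P :=
    memLp_top_of_bound (hχ.mono (𝓕.le _)).aestronglyMeasurable B (ae_of_all _ hB)
  simp only [SimpleProcess.integral, Finset.mul_sum]
  rw [integral_finsetSum]
  · refine Finset.sum_eq_zero fun i _ ↦ ?_
    -- An interval starting after `T` contributes nothing, since both truncated endpoints equal `T`.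
    rcases le_total (H.left i) T with hT | hT
    · have := integral_mul_increment hW (s := H.left i) (t := min (H.right i) T)
        (le_min (H.left_le_right i) hT) (ξ := fun ω ↦ χ ω * H.coeff i ω)
        ((hχ.mono (𝓕.mono zero_le)).mul (H.measurable_coeff i))
      simpa [min_eq_left hT, mul_assoc] using this
    · simp [min_eq_right hT, min_eq_right (hT.trans (H.left_le_right i))]
  · intro i _
    obtain ⟨C, hC⟩ := H.bounded_coeff i
    have h1 : MemLp (fun ω ↦ H.coeff i ω * (W (min (H.right i) T) ω - W (min (H.left i) T) ω)) 2 P :=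
      (memLp_increment hW _ _).mul (memLp_top_of_bound
        ((H.measurable_coeff i).mono (𝓕.le _)).aestronglyMeasurable C (ae_of_all _ hC))
    exact (h1.mul (r := 2) hχ2).integrable (by norm_num)

/-- No condition on the integrand is needed: outside its domain the integral is `0` by definition.
The same default keeps the mean-zero property below unconditional. -/
lemma memLp_itoIntegral (T : ℝ≥0) (f : ℝ≥0 → Ω → ℝ) : MemLp (itoIntegral 𝓕 P W T f) 2 P := by
  unfold itoIntegral
  split_ifs with h
  · exact h.choose_spec.2.1
  · exact MemLp.zero

/-- The Itô integral has conditional mean zero given the initial σ-algebra. -/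
lemma integral_mul_itoIntegral [IsProbabilityMeasure P] (hW : IsFilteredBrownian 𝓕 P W)
    (T : ℝ≥0) (f : ℝ≥0 → Ω → ℝ) {χ : Ω → ℝ} (hχ : StronglyMeasurable[𝓕 0] χ) {B : ℝ}
    (hB : ∀ ω, |χ ω| ≤ B) : ∫ ω, χ ω * itoIntegral 𝓕 P W T f ω ∂P = 0 := by
  unfold itoIntegral
  split_ifs with h
  swap
  · simp
  obtain ⟨-, hI, H, -, hH⟩ := h.choose_spec
  set I := h.choose
  have hχm := (hχ.mono (𝓕.le 0)).aestronglyMeasurable (μ := P)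
  have hχ2 : MemLp χ ∞ P := memLp_top_of_bound hχm B (ae_of_all _ hB)
  have hint (g : Ω → ℝ) (hg : MemLp g 2 P) : Integrable (fun ω ↦ χ ω * g ω) P :=
    (hg.mul (r := 2) hχ2).integrable (by norm_num)
  -- Multiplication by the bounded `χ` turns `L²` convergence of the simple integrals into `L¹`
  -- convergence of the products.
  have key : Tendsto (fun n ↦ ∫ ω, χ ω * (H n).integral W T ω ∂P) atTop
      (𝓝 (∫ ω, χ ω * I ω ∂P)) := by
    refine tendsto_integral_of_L1' _ (hint I hI).aestronglyMeasurable
      (Eventually.of_forall fun n ↦ hint _ (memLp_simpleIntegral hW (H n) T)) ?_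
    refine tendsto_of_tendsto_of_tendsto_of_le_of_le tendsto_const_nhds
      (h := fun n ↦ ENNReal.ofReal B * eLpNorm (fun ω ↦ (H n).integral W T ω - I ω) 2 P) ?_
      (fun _ ↦ zero_le) fun n ↦ ?_
    · simpa using ENNReal.Tendsto.const_mul hH (Or.inr ENNReal.ofReal_ne_top)
    · have hm := ((memLp_simpleIntegral hW (H n) T).sub hI)
      calc _ ≤ ENNReal.ofReal B * eLpNorm (fun ω ↦ (H n).integral W T ω - I ω) 1 P := by
            refine eLpNorm_le_mul_eLpNorm_of_ae_le_mul (ae_of_all _ fun ω ↦ ?_) 1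
            simp only [Pi.sub_apply, ← mul_sub, norm_mul]
            gcongr
            exact hB ω
        _ ≤ _ := by
            refine mul_le_mul' le_rfl ?_
            exact eLpNorm_le_eLpNorm_of_exponent_le (by norm_num) hm.aestronglyMeasurable
  refine tendsto_nhds_unique key ?_
  simp only [integral_mul_simpleIntegral hW _ T hχ hB]
  exact tendsto_const_nhds

end Ito

/-! ### Test functions and quadratic entropies -/

section Entropy

variable {d : ℕ}

lemma isTestFunction_mul {θ : ℝ → ℝ} (hθ : ContDiff ℝ 1 θ) (hθc : HasCompactSupport θ)
    (hθ0 : ∀ t, 0 ≤ θ t) {φ : Space d → ℝ} (hφ : ContDiff ℝ 2 φ) (hφc : HasCompactSupport φ)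
    (hφ0 : ∀ x, 0 ≤ φ x) : IsTestFunction fun t x ↦ θ t * φ x := by
  have hθ' : Continuous (deriv θ) := hθ.continuous_deriv le_rfl
  have hφ1 : ContDiff ℝ 1 (fderiv ℝ φ) := hφ.fderiv_right (by norm_num [one_add_one_eq_two])
  have hd : Differentiable ℝ φ := hφ.differentiable (by norm_num)
  have hd1 : Differentiable ℝ (fderiv ℝ φ) := hφ1.differentiable (by norm_num)
  have hf (t : ℝ) : fderiv ℝ (fun x ↦ θ t * φ x) = fun x ↦ θ t • fderiv ℝ φ x :=
    funext fun x ↦ fderiv_const_mul (hd x) _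
  have hf2 (t : ℝ) (x : Space d) : fderiv ℝ (fun x ↦ θ t • fderiv ℝ φ x) x
      = θ t • fderiv ℝ (fderiv ℝ φ) x := fderiv_fun_const_smul (hd1 x) _
  refine ⟨?_, ?_, fun x ↦ hθ.mul contDiff_const, ?_, fun t ↦ contDiff_const.mul hφ, ?_, ?_,
    fun t _ x ↦ mul_nonneg (hθ0 t) (hφ0 x)⟩
  · refine HasCompactSupport.intro (hθc.isCompact.prod hφc.isCompact) fun p hp ↦ ?_
    rw [mem_prod, not_and_or] at hp
    rcases hp with hp | hp <;> simp [Function.uncurry, image_eq_zero_of_notMem_tsupport hp]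
  · have := hθ.continuous; have := hφ.continuous
    unfold Function.uncurry
    fun_prop
  · have : (fun p : ℝ × Space d ↦ deriv (fun t ↦ θ t * φ p.2) p.1)
        = fun p ↦ deriv θ p.1 * φ p.2 := by
      funext p
      exact deriv_mul_const (hθ.differentiable (by norm_num) _) _
    rw [this]
    have := hφ.continuous
    fun_prop
  · simp only [hf]
    have := hθ.continuous; have := hφ1.continuous
    fun_prop
  · simp only [hf, hf2]
    have := hθ.continuous; have := hφ1.continuous_fderiv (by norm_num)
    fun_prop

/-- A smooth compactly supported function that agrees with `(1 - t / h)²` on `[0, 1]`. -/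
lemma exists_time_cutoff {h : ℝ≥0} (hh : 0 < h) (h1 : h ≤ 1) : ∃ θ : ℝ → ℝ, ContDiff ℝ 1 θ ∧
    HasCompactSupport θ ∧ (∀ t, 0 ≤ θ t) ∧ θ 0 = 1 ∧
    ∀ t : ℝ≥0, t ≤ h → θ t ≤ 1 ∧ HasDerivAt θ (-timeWeight h t) t := by
  have hh' : (0 : ℝ) < h := by exact_mod_cast hh
  let η : ContDiffBump (0 : ℝ) := ⟨2, 3, by norm_num, by norm_num⟩
  have hη (t : ℝ) (ht : |t| < 2) : ∀ᶠ s in 𝓝 t, η s = 1 := by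
    have : {s : ℝ | |s| < 2} ∈ 𝓝 t := (isOpen_lt continuous_abs continuous_const).mem_nhds ht
    filter_upwards [this] with s hs
    exact η.one_of_mem_closedBall (by simpa using (le_of_lt hs : |s| ≤ 2))
  -- The square keeps the cutoff both nonnegative and `C¹` beyond `t = h`, where `1 - t / h` changes
  -- sign. The bump is `1` near `[0, h]` because `h ≤ 1`.
  refine ⟨fun t ↦ η t * (1 - t / h) ^ 2, ?_, ?_, ?_, ?_, fun t ht ↦ ?_⟩
  · exact η.contDiff.mul (by fun_prop)
  · exact η.hasCompactSupport.mul_right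
  · exact fun t ↦ mul_nonneg η.nonneg (sq_nonneg _)
  · simp [(hη 0 (by norm_num)).self_of_nhds]
  · have ht' : (t : ℝ) ≤ h := by exact_mod_cast ht
    have h1' : (h : ℝ) ≤ 1 := by exact_mod_cast h1
    have hlt : |(t : ℝ)| < 2 := by rw [NNReal.abs_eq]; linarith
    have hdiv : (t : ℝ) / h ≤ 1 := div_le_one_of_le₀ ht' hh'.le
    have hdiv0 : 0 ≤ (t : ℝ) / h := by positivity
    constructor
    · simp only [(hη t hlt).self_of_nhds, one_mul]
      nlinarith
    · have h2 : HasDerivAt (fun s : ℝ ↦ (1 - s / h) ^ 2) (-timeWeight h t) t := by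
        have h3 := (((hasDerivAt_id (t : ℝ)).div_const (h : ℝ)).const_sub 1).pow 2
        refine h3.congr_deriv ?_
        simp [timeWeight]
        ring
      refine h2.congr_of_eventuallyEq ?_
      filter_upwards [hη t hlt] with s hs
      simp [hs]

lemma deriv_quadratic (a : ℝ) : deriv (fun r : ℝ ↦ (r - a) ^ 2) = fun r ↦ 2 * (r - a) := by
  funext r
  simp

lemma deriv2_quadratic (a : ℝ) : deriv (deriv (fun r : ℝ ↦ (r - a) ^ 2)) = fun _ ↦ 2 := by
  rw [deriv_quadratic]
  funext r
  simp

/-- The flux `ζ` is the primitive of `β' F'` from `0`. If `F'` grows like `|r| ^ m`, then `ζ` grows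
like `|r| ^ (m + 2)`, and this exponent is at least `2`, as the moment bounds require. -/
lemma exists_quadratic_entropyPair {F : ℝ → Space d} (hF : FluxAssumption F) (a : ℝ) :
    ∃ ζ : ℝ → Space d, IsConvexEntropyPair F (fun r ↦ (r - a) ^ 2) ζ ∧
      ∃ (C : ℝ) (p : ℕ), 0 ≤ C ∧ 2 ≤ p ∧ ∀ r, ‖ζ r‖ ≤ C * (1 + |r| ^ p) := by
  have hc : Continuous fun s : ℝ ↦ (2 * (s - a)) • deriv F s := by
    have := hF.contDiff.continuous_deriv (by norm_num)
    fun_prop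
  have hζ (r : ℝ) : HasDerivAt (fun r ↦ ∫ s in (0 : ℝ)..r, (2 * (s - a)) • deriv F s)
      ((2 * (r - a)) • deriv F r) r :=
    intervalIntegral.integral_hasDerivAt_right (hc.intervalIntegrable _ _)
      (hc.stronglyMeasurableAtFilter _ _) hc.continuousAt
  obtain ⟨C, m, hC⟩ := hF.growth_deriv
  refine ⟨fun r ↦ ∫ s in (0 : ℝ)..r, (2 * (s - a)) • deriv F s, ⟨by fun_prop,
    fun r ↦ sq_nonneg _, fun r ↦ by rw [deriv2_quadratic]; norm_num,
    fun r ↦ by rw [deriv_quadratic]; exact hζ r, ⟨2 * (1 + a ^ 2), 2, fun r ↦ ?_⟩,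
    ⟨2 * (1 + |a|), 1, fun r ↦ ?_⟩, ⟨2, 0, fun r ↦ ?_⟩⟩,
    4 * |C| * (1 + |a|), m + 2, by positivity, by lia, fun r ↦ ?_⟩
  · rw [Real.norm_of_nonneg (sq_nonneg _), sq_abs]
    nlinarith [sq_nonneg (r + a), sq_nonneg (a * r)]
  · rw [deriv_quadratic, Real.norm_eq_abs, abs_mul, abs_two, pow_one, mul_assoc]
    have := abs_sub r a
    nlinarith [mul_nonneg (abs_nonneg a) (abs_nonneg r)]
  · rw [deriv2_quadratic]; norm_num
  · have h1 : ‖∫ s in (0 : ℝ)..r, (2 * (s - a)) • deriv F s‖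
        ≤ (2 * (|r| + |a|)) * (|C| * (1 + |r| ^ m)) * |r - 0| := by
      refine intervalIntegral.norm_integral_le_of_norm_le_const fun s hs ↦ ?_
      have hs' : |s| ≤ |r| := by
        rcases le_total 0 r with h | h
        · rw [uIoc_of_le h] at hs
          rw [abs_of_pos hs.1, abs_of_nonneg h]; exact hs.2
        · rw [uIoc_of_ge h] at hs
          rw [abs_of_nonpos hs.2, abs_of_nonpos h]; linarith [hs.1]
      rw [norm_smul, Real.norm_eq_abs, abs_mul, abs_two]
      have h2 : |s - a| ≤ |r| + |a| := (abs_sub s a).trans (by linarith)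
      have h3 : ‖deriv F s‖ ≤ |C| * (1 + |r| ^ m) := by
        refine (hC s).trans ?_
        gcongr
        exact le_abs_self C
      gcongr
    rw [sub_zero] at h1
    refine h1.trans ?_
    set R := |r|
    set A := |a|
    have hR : 0 ≤ R := abs_nonneg r
    have hA : 0 ≤ A := abs_nonneg a
    have h4 : (R + A) * (1 + R ^ m) * R ≤ 2 * (1 + A) * (1 + R ^ (m + 2)) := by
      rcases le_total R 1 with h | h
      · have h5 : R ^ m ≤ 1 := pow_le_one₀ hR h
        calc (R + A) * (1 + R ^ m) * R ≤ (1 + A) * (1 + 1) * 1 := by gcongr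
          _ ≤ 2 * (1 + A) * (1 + R ^ (m + 2)) := by
            have : 0 ≤ R ^ (m + 2) := by positivity
            nlinarith
      · have h5 : 1 ≤ R ^ m := one_le_pow₀ h
        have h6 : R + A ≤ (1 + A) * R := by nlinarith
        calc (R + A) * (1 + R ^ m) * R ≤ ((1 + A) * R) * (R ^ m + R ^ m) * R := by gcongr
          _ = 2 * (1 + A) * R ^ (m + 2) := by ring
          _ ≤ _ := by gcongr; linarith
    calc 2 * (R + A) * (|C| * (1 + R ^ m)) * R = 2 * |C| * ((R + A) * (1 + R ^ m) * R) := by ring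
      _ ≤ 2 * |C| * (2 * (1 + A) * (1 + R ^ (m + 2))) := by gcongr
      _ = _ := by ring

/-! ### Estimates for the flux and noise terms -/

/-- Working with extended norms avoids any measurability or integrability condition on `f`, so none
has to be verified for the flux and noise terms. -/
lemma enorm_integral_le_powerMoment {K : Set (Space d)} (hK : IsCompact K) {C : ℝ} (hC : 0 ≤ C)
    (p : ℕ) (v : L2 d) {f : Space d → ℝ} (hf : ∀ᵐ x, x ∈ K → |f x| ≤ C * (1 + |v x| ^ p))
    (hf0 : ∀ x ∉ K, f x = 0) :
    ‖∫ x, f x‖ₑ ≤ ENNReal.ofReal C * (volume K + powerMoment p v) := by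
  have hm : AEMeasurable (fun x ↦ ‖v x‖ₑ ^ p) := (Lp.aestronglyMeasurable _).enorm.pow_const _
  calc ‖∫ x, f x‖ₑ ≤ ∫⁻ x, ‖f x‖ₑ := enorm_integral_le_lintegral_enorm _
    _ ≤ ∫⁻ x, ENNReal.ofReal C * (K.indicator 1 x + ‖v x‖ₑ ^ p) := by
        refine lintegral_mono_ae ?_
        filter_upwards [hf] with x hx
        by_cases hxK : x ∈ K
        · rw [indicator_of_mem hxK, Pi.one_apply, ← ofReal_norm, ← ofReal_norm, Real.norm_eq_abs,
            Real.norm_eq_abs, ← ENNReal.ofReal_pow (abs_nonneg _), ← ENNReal.ofReal_one,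
            ← ENNReal.ofReal_add zero_le_one (by positivity), ← ENNReal.ofReal_mul hC]
          exact ENNReal.ofReal_le_ofReal (hx hxK)
        · simp [hf0 x hxK]
    _ = _ := by
        have h1 : AEMeasurable (fun x ↦ K.indicator 1 x + ‖v x‖ₑ ^ p) :=
          (measurable_one.indicator hK.measurableSet).aemeasurable.add hm
        rw [lintegral_const_mul'' _ h1, lintegral_add_left (measurable_one.indicator hK.measurableSet),
          lintegral_indicator_one hK.measurableSet, powerMoment]

lemma norm_gradient_const_mul {φ : Space d → ℝ} (hφ : Differentiable ℝ φ) (c : ℝ) (x : Space d) :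
    ‖∇ (fun y ↦ c * φ y) x‖ = |c| * ‖fderiv ℝ φ x‖ := by
  rw [gradient, LinearIsometryEquiv.norm_map, fderiv_const_mul (hφ x), norm_smul, Real.norm_eq_abs]

/-- The factor `c` will be the value `θ(t)` of the time cutoff; uniformity in `|c| ≤ 1` makes the
constant independent of `h`. -/
lemma exists_flux_bound {ζ : ℝ → Space d} {φ : Space d → ℝ} (hφ : ContDiff ℝ 2 φ)
    (hφc : HasCompactSupport φ) {C₀ : ℝ} {p : ℕ} (hC₀ : 0 ≤ C₀)
    (hζ : ∀ r, ‖ζ r‖ ≤ C₀ * (1 + |r| ^ p)) :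
    ∃ C : ℝ, 0 ≤ C ∧ ∀ (c : ℝ) (v : L2 d), |c| ≤ 1 →
      ‖∫ x, inner ℝ (ζ (v x)) (∇ (fun y ↦ c * φ y) x)‖ₑ
        ≤ ENNReal.ofReal C * (volume (tsupport φ) + powerMoment p v) := by
  have hd : Differentiable ℝ φ := hφ.differentiable (by norm_num)
  obtain ⟨B, hB⟩ := (hφ.continuous_fderiv (by norm_num)).bounded_above_of_compact_support
    (hφc.fderiv (𝕜 := ℝ))
  have hB0 : 0 ≤ B := (norm_nonneg _).trans (hB 0)
  refine ⟨C₀ * B, by positivity, fun c v hc ↦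
    enorm_integral_le_powerMoment hφc (by positivity) p v (ae_of_all _ fun x _ ↦ ?_) fun x hx ↦ ?_⟩
  · have h1 := norm_gradient_const_mul hd c x
    calc _ ≤ ‖ζ (v x)‖ * ‖∇ (fun y ↦ c * φ y) x‖ := abs_real_inner_le_norm _ _
      _ ≤ (C₀ * (1 + |v x| ^ p)) * (1 * B) := by
          rw [h1]; gcongr
          exacts [hζ _, hB x]
      _ = _ := by ring
  · have h1 := norm_gradient_const_mul hd c x
    rw [fderiv_of_notMem_tsupport (𝕜 := ℝ) hx, norm_zero, mul_zero, norm_eq_zero] at h1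
    rw [h1, inner_zero_right]

lemma exists_noise_bound {σ : Space d → ℝ → ℝ} (hσ : NoiseAssumption σ) {φ : Space d → ℝ}
    (hφ : Continuous φ) (hφc : HasCompactSupport φ) :
    ∃ C : ℝ, 0 ≤ C ∧ ∀ (c : ℝ) (v : L2 d), |c| ≤ 1 →
      ‖∫ x, σ x (v x) ^ 2 * 2 * (c * φ x)‖ₑ
        ≤ ENNReal.ofReal C * (volume (tsupport φ) + powerMoment 2 v) := by
  obtain ⟨g, hg0, hgi, -, hg⟩ := hσ.growth
  obtain ⟨B, hB⟩ := hφ.bounded_above_of_compact_support hφc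
  have hB0 : 0 ≤ B := (norm_nonneg _).trans (hB 0)
  obtain ⟨G, hG⟩ : ∃ G : ℝ, ∀ᵐ x, g x ≤ G := by
    refine ⟨(eLpNorm g ∞ volume).toReal, ?_⟩
    rw [eLpNorm_exponent_top]
    filter_upwards [ae_le_eLpNormEssSup (f := g) (μ := volume)] with x hx
    have h2 := hgi.2
    rw [eLpNorm_exponent_top] at h2
    have := ENNReal.toReal_mono h2.ne hx
    rw [toReal_enorm] at this
    exact (le_abs_self _).trans this
  -- One factor `2` is `β''`, the other comes from `(1 + r)² ≤ 2 (1 + r²)`.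
  refine ⟨4 * G ^ 2 * B, by positivity, fun c v hc ↦
    enorm_integral_le_powerMoment hφc (by positivity) 2 v ?_ fun x hx ↦ ?_⟩
  · filter_upwards [hG] with x hx _
    have h1 : σ x (v x) ^ 2 ≤ G ^ 2 * (2 * (1 + |v x| ^ 2)) := by
      calc σ x (v x) ^ 2 = |σ x (v x)| ^ 2 := (sq_abs _).symm
        _ ≤ (g x * (1 + |v x|)) ^ 2 := by gcongr; exact hg _ _
        _ = g x ^ 2 * (1 + |v x|) ^ 2 := by ring
        _ ≤ G ^ 2 * (2 * (1 + |v x| ^ 2)) := by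
            have := hg0 x
            gcongr
            nlinarith [sq_nonneg (1 - |v x|)]
    have h2 : |φ x| ≤ B := hB x
    rw [abs_mul, abs_mul, abs_two, abs_mul, abs_of_nonneg (sq_nonneg (σ x (v x)))]
    calc σ x (v x) ^ 2 * 2 * (|c| * |φ x|)
        ≤ G ^ 2 * (2 * (1 + |v x| ^ 2)) * 2 * (1 * B) := by gcongr
      _ = _ := by ring
  · simp [image_eq_zero_of_notMem_tsupport hx]

end Entropy

/-! ### The averaged entropy inequality -/

section Averaged

variable {Ω : Type*} {mΩ : MeasurableSpace Ω} {P : Measure Ω} {d : ℕ}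

lemma integral_le_toReal_of_enorm_le {α : Type*} [MeasurableSpace α] {μ : Measure α}
    {f : α → ℝ} {A : α → ℝ≥0∞} (hA : ∫⁻ x, A x ∂μ ≠ ∞) (hf : ∀ᵐ x ∂μ, ‖f x‖ₑ ≤ A x) :
    ∫ x, f x ∂μ ≤ (∫⁻ x, A x ∂μ).toReal := by
  refine (le_abs_self _).trans ?_
  rw [← Real.norm_eq_abs, ← toReal_enorm]
  exact ENNReal.toReal_mono hA
    ((enorm_integral_le_lintegral_enorm _).trans (lintegral_mono_ae hf))

/-- A process whose `L^p` norms have uniformly bounded `p`-th moments on `[0, 1]`. -/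
lemma exists_moment_bound {u : ℝ≥0 → Ω → L2 d} {p : ℕ}
    (hu : (⨆ t ∈ Icc (0 : ℝ≥0) 1, ∫⁻ ω, (∫⁻ x, ‖u t ω x‖ₑ ^ p) ∂P) < ∞) :
    ∃ M : ℝ≥0, ∀ t ≤ 1, ∫⁻ ω, powerMoment p (u t ω) ∂P ≤ M := by
  refine ⟨(⨆ t ∈ Icc (0 : ℝ≥0) 1, ∫⁻ ω, (∫⁻ x, ‖u t ω x‖ₑ ^ p) ∂P).toNNReal, fun t ht ↦ ?_⟩
  rw [ENNReal.coe_toNNReal hu.ne]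
  exact le_iSup₂ (f := fun (t : ℝ≥0) (_ : t ∈ Icc (0 : ℝ≥0) 1) ↦
    ∫⁻ ω, (∫⁻ x, ‖u t ω x‖ₑ ^ p) ∂P) t ⟨zero_le, ht⟩

lemma memLp_initial {𝓕 : Filtration ℝ≥0 mΩ} {u₀ : Ω → L2 d} (hu₀ : InitialAssumption 𝓕 P u₀) :
    MemLp u₀ 2 P := by
  refine ⟨(hu₀.measurable.mono (𝓕.le 0)).aestronglyMeasurable, ?_⟩
  rw [eLpNorm_lt_top_iff_lintegral_rpow_enorm_lt_top (by simp) (by simp)]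
  have h : ∫⁻ ω, powerMoment 2 (u₀ ω) ∂P < ∞ := hu₀.moments 2 le_rfl
  simp only [powerMoment_two] at h
  simpa only [ENNReal.toReal_ofNat, ENNReal.rpow_ofNat] using h

lemma integrable_quadEntropy {α : Type*} [MeasurableSpace α] {μ : Measure α} [IsFiniteMeasure μ]
    {f : α → L2 d} (hf : MemLp f 2 μ) {φ : Space d → ℝ} (hφ : Continuous φ)
    (hc : HasCompactSupport φ) (a : ℝ) : Integrable (fun z ↦ quadEntropy φ a (f z)) μ := by
  obtain ⟨C, -, hC⟩ := abs_quadEntropy_le hφ hc a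
  refine Integrable.mono' (g := fun z ↦ C * (1 + ‖f z‖ ^ 2)) ?_
    ((continuous_quadEntropy hφ hc a).comp_aestronglyMeasurable hf.1) (ae_of_all _ fun z ↦ hC _)
  exact ((integrable_const _).add (hf.integrable_norm_pow two_ne_zero)).const_mul _

variable [IsProbabilityMeasure P]

lemma lintegral_powerMoment_le {u : ℝ≥0 → Ω → L2 d}
    (hum : StronglyMeasurable (Function.uncurry u)) {p : ℕ} {M : ℝ≥0}
    (hM : ∀ t ≤ 1, ∫⁻ ω, powerMoment p (u t ω) ∂P ≤ M) {ρ : Measure ℝ≥0} [SFinite ρ]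
    (hρ : ∀ᵐ t ∂ρ, t ≤ 1) :
    ∫⁻ z, powerMoment p (u z.1 z.2) ∂ρ.prod P ≤ M * ρ univ := by
  have hm : Measurable fun z : ℝ≥0 × Ω ↦ powerMoment p (u z.1 z.2) :=
    measurable_powerMoment_comp p hum
  rw [lintegral_prod _ hm.aemeasurable, ← lintegral_const]
  refine lintegral_mono_ae ?_
  filter_upwards [hρ] with t ht using hM t ht

lemma memLp_uncurry {u : ℝ≥0 → Ω → L2 d} (hum : StronglyMeasurable (Function.uncurry u))
    {M : ℝ≥0} (hM : ∀ t ≤ 1, ∫⁻ ω, powerMoment 2 (u t ω) ∂P ≤ M) {ρ : Measure ℝ≥0}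
    [IsFiniteMeasure ρ] (hρ : ∀ᵐ t ∂ρ, t ≤ 1) :
    MemLp (fun z : ℝ≥0 × Ω ↦ u z.1 z.2) 2 (ρ.prod P) := by
  refine ⟨hum.aestronglyMeasurable, ?_⟩
  rw [eLpNorm_lt_top_iff_lintegral_rpow_enorm_lt_top (by simp) (by simp)]
  have h := lintegral_powerMoment_le hum hM hρ
  simp only [powerMoment_two] at h
  simp only [ENNReal.toReal_ofNat, ENNReal.rpow_ofNat]
  exact h.trans_lt (ENNReal.mul_lt_top ENNReal.coe_lt_top (measure_lt_top _ _))

/-- The expected cumulative size of an error term over a short time interval. -/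
lemma lintegral_timeMeasure_error {u : ℝ≥0 → Ω → L2 d}
    (hum : StronglyMeasurable (Function.uncurry u)) {p : ℕ} {M : ℝ≥0}
    (hM : ∀ t ≤ 1, ∫⁻ ω, powerMoment p (u t ω) ∂P ≤ M) (c k : ℝ≥0) {h : ℝ≥0} (h1 : h ≤ 1) :
    Measurable (fun ω ↦ ∫⁻ t, c * (k + powerMoment p (u t ω)) ∂timeMeasure h) ∧
      ∫⁻ ω, (∫⁻ t, c * (k + powerMoment p (u t ω)) ∂timeMeasure h) ∂P
        ≤ (c * (k + M) * h : ℝ≥0) := by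
  have hm : Measurable fun z : ℝ≥0 × Ω ↦ (c : ℝ≥0∞) * (k + powerMoment p (u z.1 z.2)) :=
    ((measurable_powerMoment_comp p hum).const_add _).const_mul _
  refine ⟨hm.lintegral_prod_left', ?_⟩
  have hae : ∀ᵐ t ∂timeMeasure h, t ≤ 1 :=
    (ae_timeMeasure_mem h).mono fun t ht ↦ ht.2.trans h1
  have h2 := lintegral_powerMoment_le hum hM hae
  have h3 : ∫⁻ ω, (∫⁻ t, c * (k + powerMoment p (u t ω)) ∂timeMeasure h) ∂P
      = ∫⁻ z, c * (k + powerMoment p (u z.1 z.2)) ∂(timeMeasure h).prod P :=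
    (lintegral_prod_symm _ hm.aemeasurable).symm
  have hm' : Measurable fun z : ℝ≥0 × Ω ↦ (k : ℝ≥0∞) + powerMoment p (u z.1 z.2) :=
    (measurable_powerMoment_comp p hum).const_add _
  rw [h3, lintegral_const_mul _ hm', lintegral_add_left measurable_const, lintegral_const]
  rw [timeMeasure_univ] at h2
  have h4 : ((timeMeasure h).prod P) univ = h := by
    rw [← univ_prod_univ, Measure.prod_prod]; simp [timeMeasure_univ]
  rw [h4]
  calc (c : ℝ≥0∞) * (k * h + ∫⁻ z, powerMoment p (u z.1 z.2) ∂(timeMeasure h).prod P)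
      ≤ c * (k * h + M * h) := by gcongr
    _ = _ := by push_cast; ring

/-- The entropy inequality for `(u - a)²`, averaged over short times and over events known at
time zero. -/
theorem exists_averaged_entropy_bound {𝓕 : Filtration ℝ≥0 mΩ} {W : ℝ≥0 → Ω → ℝ}
    (hW : IsFilteredBrownian 𝓕 P W) {F : ℝ → Space d} (hF : FluxAssumption F)
    {σ : Space d → ℝ → ℝ} (hσ : NoiseAssumption σ) {u₀ : Ω → L2 d}
    (hu₀ : InitialAssumption 𝓕 P u₀) {u : ℝ≥0 → Ω → L2 d}
    (hu : IsStochasticEntropySolution 𝓕 P W F σ u₀ u) {φ : Space d → ℝ} (hφ : ContDiff ℝ 2 φ)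
    (hφc : HasCompactSupport φ) (hφ0 : ∀ x, 0 ≤ φ x) (a : ℝ) {χ : Ω → ℝ}
    (hχ : StronglyMeasurable[𝓕 0] χ) (hχ0 : ∀ ω, 0 ≤ χ ω) (hχ1 : ∀ ω, χ ω ≤ 1) :
    ∃ C : ℝ, ∀ h : ℝ≥0, 0 < h → h ≤ 1 →
      ∫ z, χ z.2 * quadEntropy φ a (u z.1 z.2) ∂(weightedTime h).prod P
        ≤ ∫ ω, χ ω * quadEntropy φ a (u₀ ω) ∂P + C * h := by
  have hum := stronglyMeasurable_uncurry_of_predictable hu.predictable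
  have hφm := hφ.continuous
  obtain ⟨ζ, hpair, C₀, p, hC₀, hp, hζ⟩ := exists_quadratic_entropyPair hF a
  obtain ⟨C₁, hC₁, hflux⟩ := exists_flux_bound hφ hφc hC₀ hζ
  obtain ⟨C₂, hC₂, hnoise⟩ := exists_noise_bound hσ hφm hφc
  obtain ⟨M₁, hM₁⟩ := exists_moment_bound (hu.moments 1 one_pos p hp)
  obtain ⟨M₂, hM₂⟩ := exists_moment_bound (hu.moments 1 one_pos 2 le_rfl)
  lift C₁ to ℝ≥0 using hC₁
  lift C₂ to ℝ≥0 using hC₂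
  obtain ⟨k, hk⟩ : ∃ k : ℝ≥0, volume (tsupport φ) = k :=
    ⟨_, (ENNReal.coe_toNNReal hφc.isCompact.measure_lt_top.ne).symm⟩
  simp only [hk, ENNReal.ofReal_coe_nnreal] at hflux hnoise
  -- The constant may depend on `a`, through the growth of `ζ`, but not on `h`.
  refine ⟨C₁ * (k + M₁) + C₂ * (k + M₂), fun h hh h1 ↦ ?_⟩
  have := isProbabilityMeasure_weightedTime hh
  obtain ⟨θ, hθ, hθc, hθ0, hθ00, hθh⟩ := exists_time_cutoff hh h1
  obtain ⟨hR₁m, hR₁⟩ := lintegral_timeMeasure_error hum hM₁ C₁ k h1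
  obtain ⟨hR₂m, hR₂⟩ := lintegral_timeMeasure_error hum hM₂ C₂ k h1
  set R₁ : Ω → ℝ≥0∞ := fun ω ↦ ∫⁻ t, C₁ * (k + powerMoment p (u t ω)) ∂timeMeasure h
  set R₂ : Ω → ℝ≥0∞ := fun ω ↦ ∫⁻ t, C₂ * (k + powerMoment 2 (u t ω)) ∂timeMeasure h
  set I : Ω → ℝ := itoIntegral 𝓕 P W h
    (noiseIntegrand σ u (fun r ↦ (r - a) ^ 2) fun t x ↦ θ t * φ x)
  have hR₁' : ∫⁻ ω, R₁ ω ∂P ≠ ∞ := (hR₁.trans_lt ENNReal.coe_lt_top).ne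
  have hR₂' : ∫⁻ ω, R₂ ω ∂P ≠ ∞ := (hR₂.trans_lt ENNReal.coe_lt_top).ne
  -- The entropy inequality with `T = h`, rearranged pathwise: flux and noise terms are replaced by
  -- the majorants `R₁`, `R₂`, whose expectations are `O(h)`.
  have hpath : ∀ᵐ ω ∂P, ∫ t, quadEntropy φ a (u t ω) ∂weightedTime h
      ≤ quadEntropy φ a (u₀ ω) + (R₁ ω).toReal + (R₂ ω).toReal + I ω := by
    filter_upwards [hu.entropy _ (isTestFunction_mul hθ hθc hθ0 hφ hφc hφ0) _ ζ hpair h hh,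
      ae_lt_top hR₁m hR₁', ae_lt_top hR₂m hR₂'] with ω hω hω₁ hω₂
    rw [entropyFunctional] at hω
    have e1 : ∫ x, (u₀ ω x - a) ^ 2 * (θ 0 * φ x) = quadEntropy φ a (u₀ ω) := by
      simp [hθ00, quadEntropy]
    have e2 : ∫ t, (∫ x, (u t ω x - a) ^ 2 * deriv (fun s ↦ θ s * φ x) t) ∂timeMeasure h
        = -∫ t, quadEntropy φ a (u t ω) ∂weightedTime h := by
      rw [integral_weightedTime, ← integral_neg]
      refine integral_congr_ae ?_
      filter_upwards [ae_timeMeasure_mem h] with t ht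
      rw [quadEntropy, ← integral_const_mul, ← integral_neg]
      refine integral_congr_ae (ae_of_all _ fun x ↦ ?_)
      simp only [((hθh t ht.2).2.mul_const (φ x)).deriv]
      ring
    have hθabs (t : ℝ≥0) (ht : t ≤ h) : |θ t| ≤ 1 := by
      rw [abs_of_nonneg (hθ0 _)]; exact (hθh t ht).1
    have e3 : ∫ t, (∫ x, inner ℝ (ζ (u t ω x)) (∇ (fun x ↦ θ t * φ x) x)) ∂timeMeasure h
        ≤ (R₁ ω).toReal := by
      refine integral_le_toReal_of_enorm_le hω₁.ne ?_
      filter_upwards [ae_timeMeasure_mem h] with t ht using hflux _ _ (hθabs t ht.2)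
    have e4 : ∫ t, (∫ x, σ x (u t ω x) ^ 2 * deriv (deriv fun r ↦ (r - a) ^ 2) (u t ω x)
        * (θ t * φ x)) ∂timeMeasure h ≤ (R₂ ω).toReal := by
      refine integral_le_toReal_of_enorm_le hω₂.ne ?_
      rw [deriv2_quadratic]
      filter_upwards [ae_timeMeasure_mem h] with t ht using hnoise _ _ (hθabs t ht.2)
    have e5 : 0 ≤ (R₂ ω).toReal := ENNReal.toReal_nonneg
    rw [e1, e2] at hω
    change 0 ≤ _ + I ω at hω
    linarith
  have hu2 := memLp_uncurry (ρ := weightedTime h) hum hM₂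
    ((ae_weightedTime_mem h).mono fun t ht ↦ ht.2.trans h1)
  have hQ := integrable_quadEntropy hu2 hφm hφc a
  have hQ₀ := integrable_quadEntropy (memLp_initial hu₀) hφm hφc a
  have hχm := hχ.mono (𝓕.le 0)
  have hχb (ω : Ω) : ‖χ ω‖ ≤ 1 := by rw [Real.norm_of_nonneg (hχ0 ω)]; exact hχ1 ω
  have hχint {g : Ω → ℝ} (hg : Integrable g P) : Integrable (fun ω ↦ χ ω * g ω) P :=
    hg.bdd_mul hχm.aestronglyMeasurable (ae_of_all _ hχb)
  have hI : Integrable I P := (memLp_itoIntegral h _).integrable (by norm_num)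
  have hI0 : ∫ ω, χ ω * I ω ∂P = 0 := integral_mul_itoIntegral hW h _ hχ hχb
  have hR₁i : Integrable (fun ω ↦ (R₁ ω).toReal) P :=
    integrable_toReal_of_lintegral_ne_top hR₁m.aemeasurable hR₁'
  have hR₂i : Integrable (fun ω ↦ (R₂ ω).toReal) P :=
    integrable_toReal_of_lintegral_ne_top hR₂m.aemeasurable hR₂'
  have hRle {R : Ω → ℝ≥0∞} (hRm : Measurable R) (hR' : ∫⁻ ω, R ω ∂P ≠ ∞) {c : ℝ≥0}
      (hR : ∫⁻ ω, R ω ∂P ≤ c) (hRi : Integrable (fun ω ↦ (R ω).toReal) P) :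
      ∫ ω, χ ω * (R ω).toReal ∂P ≤ c := by
    calc ∫ ω, χ ω * (R ω).toReal ∂P ≤ ∫ ω, (R ω).toReal ∂P :=
          integral_mono (hχint hRi) hRi fun ω ↦
            mul_le_of_le_one_left ENNReal.toReal_nonneg (hχ1 ω)
      _ = (∫⁻ ω, R ω ∂P).toReal := integral_toReal hRm.aemeasurable (ae_lt_top hRm hR')
      _ ≤ c := by simpa using ENNReal.toReal_mono ENNReal.coe_ne_top hR
  have hχz : Integrable (fun z : ℝ≥0 × Ω ↦ χ z.2 * quadEntropy φ a (u z.1 z.2))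
      ((weightedTime h).prod P) :=
    hQ.bdd_mul (hχm.comp_measurable measurable_snd).aestronglyMeasurable
      (ae_of_all _ fun z ↦ hχb z.2)
  have hleft : Integrable (fun ω ↦ χ ω * ∫ t, quadEntropy φ a (u t ω) ∂weightedTime h) P :=
    hχint hQ.integral_prod_right
  rw [integral_prod_symm _ hχz]
  simp only [integral_const_mul]
  have i₁ : Integrable (fun ω ↦ χ ω * quadEntropy φ a (u₀ ω) + χ ω * (R₁ ω).toReal) P :=
    (hχint hQ₀).add (hχint hR₁i)
  have i₂ : Integrable (fun ω ↦ χ ω * quadEntropy φ a (u₀ ω) + χ ω * (R₁ ω).toReal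
      + χ ω * (R₂ ω).toReal) P := i₁.add (hχint hR₂i)
  calc ∫ ω, χ ω * ∫ t, quadEntropy φ a (u t ω) ∂weightedTime h ∂P
      ≤ ∫ ω, (χ ω * quadEntropy φ a (u₀ ω) + χ ω * (R₁ ω).toReal + χ ω * (R₂ ω).toReal
          + χ ω * I ω) ∂P := by
        refine integral_mono_ae hleft (i₂.add (hχint hI)) ?_
        filter_upwards [hpath] with ω hω
        have := mul_le_mul_of_nonneg_left hω (hχ0 ω)
        linarith
    _ = ∫ ω, χ ω * quadEntropy φ a (u₀ ω) ∂P + ∫ ω, χ ω * (R₁ ω).toReal ∂P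
          + ∫ ω, χ ω * (R₂ ω).toReal ∂P := by
        rw [integral_add i₂ (hχint hI), integral_add i₁ (hχint hR₂i),
          integral_add (hχint hQ₀) (hχint hR₁i), hI0, add_zero]
    _ ≤ _ := by
        have h1 := hRle hR₁m hR₁' hR₁ hR₁i
        have h2 := hRle hR₂m hR₂' hR₂ hR₂i
        push_cast at h1 h2
        linarith

end Averaged

/-! ### Weak convergence of short-time averages -/

section WeakLimit

variable {Ω : Type*} {mΩ : MeasurableSpace Ω} {P : Measure Ω} [IsProbabilityMeasure P]
  {H : Type*} [NormedAddCommGroup H] [InnerProductSpace ℝ H]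

/-- The short-time average of `E ⟪U t, g⟫`. -/
noncomputable def avgPairing (P : Measure Ω) (U : ℝ≥0 × Ω → H) (g : Ω → H) (h : ℝ≥0) : ℝ :=
  ∫ z, inner ℝ (U z) (g z.2) ∂(weightedTime h).prod P

lemma memLp_comp_snd {E : Type*} [NormedAddCommGroup E] {g : Ω → E} (hg : MemLp g 2 P) {h : ℝ≥0}
    (hh : 0 < h) : MemLp (fun z : ℝ≥0 × Ω ↦ g z.2) 2 ((weightedTime h).prod P) := by
  have := isProbabilityMeasure_weightedTime hh
  exact hg.comp_measurePreserving measurePreserving_snd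

lemma integrable_inner_of_memLp {α : Type*} [MeasurableSpace α] {μ : Measure α} {f g : α → H}
    (hf : MemLp f 2 μ) (hg : MemLp g 2 μ) : Integrable (fun x ↦ inner ℝ (f x) (g x)) μ :=
  memLp_one_iff_integrable.1 ((innerSL ℝ).memLp_of_bilin 1 hf hg)

/-- Cauchy–Schwarz on the product space. The norm of `g` does not depend on `h` because
`weightedTime h` has mass one. -/
lemma enorm_avgPairing_le {U : ℝ≥0 × Ω → H} {g : Ω → H} {h : ℝ≥0} (hh : 0 < h)
    (hU : MemLp U 2 ((weightedTime h).prod P)) (hg : MemLp g 2 P) :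
    ‖avgPairing P U g h‖ₑ ≤ eLpNorm U 2 ((weightedTime h).prod P) * eLpNorm g 2 P := by
  have := isProbabilityMeasure_weightedTime hh
  have h1 := eLpNorm_le_eLpNorm_mul_eLpNorm'_of_norm (p := 2) (q := 2) (r := 1) hU.1 (memLp_comp_snd hg hh).1
    (fun x y : H ↦ inner ℝ x y) 1 (ae_of_all _ fun z ↦ by
      simpa using norm_inner_le_norm (𝕜 := ℝ) (U z) (g z.2))
  have h2 : eLpNorm (fun z : ℝ≥0 × Ω ↦ g z.2) 2 ((weightedTime h).prod P) = eLpNorm g 2 P :=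
    eLpNorm_comp_measurePreserving hg.1 measurePreserving_snd
  rw [h2, eLpNorm_one_eq_lintegral_enorm] at h1
  rw [ENNReal.coe_one, one_mul] at h1
  exact (enorm_integral_le_lintegral_enorm _).trans h1

lemma avgPairing_add {U : ℝ≥0 × Ω → H} {f g : Ω → H} {h : ℝ≥0} (hh : 0 < h)
    (hU : MemLp U 2 ((weightedTime h).prod P)) (hf : MemLp f 2 P) (hg : MemLp g 2 P) :
    avgPairing P U (f + g) h = avgPairing P U f h + avgPairing P U g h := by
  simp only [avgPairing, Pi.add_apply, inner_add_right]
  exact integral_add (integrable_inner_of_memLp hU (memLp_comp_snd hf hh))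
    (integrable_inner_of_memLp hU (memLp_comp_snd hg hh))

lemma eventually_short {p : ℝ≥0 → Prop} (hp : ∀ h, 0 < h → h ≤ 1 → p h) :
    ∀ᶠ h in 𝓝[>] (0 : ℝ≥0), p h := by
  filter_upwards [Ioc_mem_nhdsGT (one_pos (α := ℝ≥0))] with h hh using hp h hh.1 hh.2

/-- The pairings are linear in `g` and bounded by `D ‖g‖` uniformly in `h`, so the `g` for which
they vanish in the limit form a closed set. Dividing by `D + 1` avoids the case `D = 0`. -/
lemma tendsto_avgPairing_of_approx {U : ℝ≥0 × Ω → H} {D : ℝ≥0}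
    (hU : ∀ h, 0 < h → h ≤ 1 → MemLp U 2 ((weightedTime h).prod P) ∧
      eLpNorm U 2 ((weightedTime h).prod P) ≤ D) {g : Ω → H} (hg : MemLp g 2 P)
    (happ : ∀ ε : ℝ≥0∞, ε ≠ 0 → ∃ f : Ω → H, MemLp f 2 P ∧ eLpNorm (g - f) 2 P ≤ ε ∧
      Tendsto (avgPairing P U f) (𝓝[>] 0) (𝓝 0)) :
    Tendsto (avgPairing P U g) (𝓝[>] 0) (𝓝 0) := by
  rw [tendsto_zero_iff_enorm_tendsto_zero, ENNReal.tendsto_nhds_zero]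
  intro ε hε
  have hD : ((D : ℝ≥0∞) + 1) ≠ 0 := by simp
  have hD' : ((D : ℝ≥0∞) + 1) ≠ ∞ := by simp
  obtain ⟨f, hf, hgf, hlim⟩ := happ (ε / 2 / (D + 1))
    (ENNReal.div_pos (ENNReal.half_pos hε.ne').ne' hD').ne'
  rw [tendsto_zero_iff_enorm_tendsto_zero, ENNReal.tendsto_nhds_zero] at hlim
  filter_upwards [hlim (ε / 2) (ENNReal.half_pos hε.ne'),
    eventually_short fun h hh h1 ↦ And.intro hh (hU h hh h1)] with h h1 h2
  obtain ⟨hh, hUh, hUD⟩ := h2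
  have e : g = f + (g - f) := by simp
  rw [e, avgPairing_add hh hUh hf (hg.sub hf)]
  calc _ ≤ ‖avgPairing P U f h‖ₑ + ‖avgPairing P U (g - f) h‖ₑ := enorm_add_le _ _
    _ ≤ ε / 2 + (D + 1) * (ε / 2 / (D + 1)) := by
        gcongr
        refine (enorm_avgPairing_le hh hUh (hg.sub hf)).trans ?_
        gcongr
        exact hUD.trans le_self_add
    _ = ε := by rw [ENNReal.mul_div_cancel hD hD', ENNReal.add_halves]

/-- Weak convergence on indicator functions with values in a dense set extends to all square
integrable functions. -/
theorem tendsto_avgPairing_of_dense {U : ℝ≥0 × Ω → H} {D : ℝ≥0}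
    (hU : ∀ h, 0 < h → h ≤ 1 → MemLp U 2 ((weightedTime h).prod P) ∧
      eLpNorm U 2 ((weightedTime h).prod P) ≤ D) {m : MeasurableSpace Ω} (hm : m ≤ mΩ)
    {S : Set H} (hS : Dense S)
    (hlim : ∀ c ∈ S, ∀ A : Set Ω, MeasurableSet[m] A →
      Tendsto (avgPairing P U (A.indicator fun _ ↦ c)) (𝓝[>] 0) (𝓝 0))
    {g : Ω → H} (hg : MemLp g 2 P) (hgm : StronglyMeasurable[m] g) :
    Tendsto (avgPairing P U g) (𝓝[>] 0) (𝓝 0) := by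
  have hind (c : H) (A : Set Ω) (hA : MeasurableSet[m] A) :
      MemLp (A.indicator fun _ ↦ c) 2 P := (memLp_const c).indicator (hm A hA)
  have hlim' (c : H) (A : Set Ω) (hA : MeasurableSet[m] A) :
      Tendsto (avgPairing P U (A.indicator fun _ ↦ c)) (𝓝[>] 0) (𝓝 0) := by
    refine tendsto_avgPairing_of_approx hU (hind c A hA) fun ε hε ↦ ?_
    obtain ⟨c', hc', hcc'⟩ := EMetric.mem_closure_iff.1 (hS c) ε (pos_iff_ne_zero.2 hε)
    refine ⟨_, hind c' A hA, ?_, hlim c' hc' A hA⟩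
    rw [← indicator_sub']
    refine (eLpNorm_indicator_le _).trans ?_
    refine (eLpNorm_le_of_ae_enorm_bound (C := ε) (ae_of_all _ fun ω ↦ ?_)).trans ?_
    · rw [Pi.sub_apply, ← edist_eq_enorm_sub]; exact hcc'.le
    · simp
  refine tendsto_avgPairing_of_approx hU hg fun ε hε ↦ ?_
  -- The approximation takes place in `L²` of the restricted measure, so that only indicators of
  -- `m`-measurable sets are used; for other sets no limit is assumed.
  have hgtrim : MemLp g 2 (P.trim hm) := 
    ⟨hgm.aestronglyMeasurable, by rw [eLpNorm_trim hm hgm]; exact hg.2⟩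
  have hadd (f f' : Ω → H) (hf : StronglyMeasurable[m] f ∧ MemLp f 2 P ∧
        Tendsto (avgPairing P U f) (𝓝[>] 0) (𝓝 0))
      (hf' : StronglyMeasurable[m] f' ∧ MemLp f' 2 P ∧
        Tendsto (avgPairing P U f') (𝓝[>] 0) (𝓝 0)) :
      StronglyMeasurable[m] (f + f') ∧ MemLp (f + f') 2 P ∧
        Tendsto (avgPairing P U (f + f')) (𝓝[>] 0) (𝓝 0) := by
    refine ⟨hf.1.add hf'.1, hf.2.1.add hf'.2.1, ?_⟩
    have := hf.2.2.add hf'.2.2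
    rw [add_zero] at this
    refine this.congr' ?_
    filter_upwards [eventually_short fun h hh h1 ↦ And.intro hh (hU h hh h1)] with h h2
    exact (avgPairing_add h2.1 h2.2.1 hf.2.1 hf'.2.1).symm
  obtain ⟨f, hf1, hf2, hf3, hf4⟩ := hgtrim.induction_dense (by simp)
    (fun f ↦ StronglyMeasurable[m] f ∧ MemLp f 2 P ∧
      Tendsto (avgPairing P U f) (𝓝[>] 0) (𝓝 0))
    (fun c s hs _ ε _ ↦ ⟨s.indicator fun _ ↦ c, by simp,
      stronglyMeasurable_const.indicator hs, hind c s hs, hlim' c s hs⟩)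
    hadd (fun f hf ↦ hf.1.aestronglyMeasurable) hε
  rw [eLpNorm_trim hm (hgm.sub hf2)] at hf1
  exact ⟨f, hf3, hf1, hf4⟩

/-- If `Y - 2 a X` is asymptotically nonpositive for each `a` and `Y` is bounded below, then `X`
tends to zero. -/
lemma tendsto_zero_of_quadratic_bound {X Y : ℝ≥0 → ℝ} {D : ℝ}
    (hY : ∀ᶠ h in 𝓝[>] (0 : ℝ≥0), -D ≤ Y h)
    (hXY : ∀ a : ℝ, ∃ C : ℝ, ∀ᶠ h in 𝓝[>] (0 : ℝ≥0), Y h - 2 * a * X h ≤ C * h) :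
    Tendsto X (𝓝[>] 0) (𝓝 0) := by
  rw [Metric.tendsto_nhds]
  intro ε hε
  -- With this choice, `X ≤ -ε` would give `Y - 2 a X ≥ -D + 2 (|D| + 1) > 1`, against the bound `C₁
  -- h < 1`. The parameter `-a` excludes `X ≥ ε` in the same way.
  set a := (|D| + 1) / ε
  have ha : a * ε = |D| + 1 := by simp only [a]; field_simp
  have ha0 : 0 < a := by positivity
  obtain ⟨C₁, h₁⟩ := hXY a
  obtain ⟨C₂, h₂⟩ := hXY (-a)
  have hsmall (C : ℝ) : ∀ᶠ h : ℝ≥0 in 𝓝[>] 0, C * h < 1 := by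
    have : Tendsto (fun h : ℝ≥0 ↦ C * (h : ℝ)) (𝓝[>] 0) (𝓝 (C * ((0 : ℝ≥0) : ℝ))) :=
      ((by fun_prop : Continuous fun h : ℝ≥0 ↦ C * (h : ℝ)).tendsto 0).mono_left
        nhdsWithin_le_nhds
    exact this.eventually_lt_const (by simp)
  filter_upwards [hY, h₁, h₂, hsmall C₁, hsmall C₂] with h hY h₁ h₂ hC₁ hC₂
  rw [Real.dist_eq, sub_zero, abs_lt]
  have hD := le_abs_self D
  have hD0 := abs_nonneg D
  constructor
  · by_contra! hc
    have := mul_le_mul_of_nonneg_left hc ha0.le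
    nlinarith
  · by_contra! hc
    have := mul_le_mul_of_nonneg_left hc ha0.le
    nlinarith

end WeakLimit

/-! ### Strong convergence of short-time averages -/

section StrongLimit

variable {d : ℕ}

lemma quadEntropy_zero {φ : Space d → ℝ} (hφ : Continuous φ) (hc : HasCompactSupport φ)
    (v : L2 d) : quadEntropy φ 0 v = inner ℝ v (mulL φ hφ hc v) := by
  simp [quadEntropy_eq hφ hc]

/-- Written so that the cross term pairs the difference `v - w` with `φ w`: for `w = u₀` this is a
pairing with an `𝓕 0`-measurable element. -/
lemma quadEntropy_zero_sub {φ : Space d → ℝ} (hφ : Continuous φ) (hc : HasCompactSupport φ)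
    (v w : L2 d) : quadEntropy φ 0 (v - w)
      = quadEntropy φ 0 v - quadEntropy φ 0 w - 2 * inner ℝ (v - w) (mulL φ hφ hc w) := by
  have hsymm : inner ℝ w (mulL φ hφ hc v) = inner ℝ v (mulL φ hφ hc w) := by
    rw [inner_mulL, inner_mulL]
    exact integral_congr_ae (ae_of_all _ fun x ↦ by simp only; ring)
  simp only [quadEntropy_zero hφ hc, map_sub, inner_sub_left, inner_sub_right, hsymm]
  ring

lemma quadEntropy_nonneg {φ : Space d → ℝ} (hφ0 : ∀ x, 0 ≤ φ x) (a : ℝ) (v : L2 d) :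
    0 ≤ quadEntropy φ a v :=
  integral_nonneg fun x ↦ mul_nonneg (sq_nonneg _) (hφ0 x)

/-- A compactly supported smooth function is a difference of two nonnegative ones. -/
lemma exists_nonneg_sub {φ : Space d → ℝ} (hφ : ContDiff ℝ 2 φ) (hc : HasCompactSupport φ) :
    ∃ f g : Space d → ℝ, ContDiff ℝ 2 f ∧ HasCompactSupport f ∧ (∀ x, 0 ≤ f x) ∧
      ContDiff ℝ 2 g ∧ HasCompactSupport g ∧ (∀ x, 0 ≤ g x) ∧ ∀ x, φ x = f x - g x := by
  obtain ⟨B, hB⟩ := hφ.continuous.bounded_above_of_compact_support hc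
  have hB0 : 0 ≤ B := (norm_nonneg _).trans (hB 0)
  obtain ⟨R, hR⟩ := hc.isCompact.isBounded.subset_closedBall (0 : Space d)
  let η : ContDiffBump (0 : Space d) :=
    ⟨max R 1, max R 1 + 1, by positivity, by linarith⟩
  have hη : ContDiff ℝ 2 fun x ↦ B * η x := contDiff_const.mul η.contDiff
  have hηc : HasCompactSupport fun x ↦ B * η x := η.hasCompactSupport.mul_left
  refine ⟨fun x ↦ φ x + B * η x, fun x ↦ B * η x, hφ.add hη, hc.add hηc, fun x ↦ ?_, hη, hηc,
    fun x ↦ mul_nonneg hB0 η.nonneg, fun x ↦ by ring⟩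
  beta_reduce
  by_cases hx : x ∈ tsupport φ
  · have : η x = 1 := η.one_of_mem_closedBall
      (Metric.closedBall_subset_closedBall (le_max_left _ _) (hR hx))
    rw [this, mul_one]
    linarith [(abs_le.1 (hB x)).1]
  · rw [image_eq_zero_of_notMem_tsupport hx, zero_add]
    exact mul_nonneg hB0 η.nonneg

variable {Ω : Type*} {mΩ : MeasurableSpace Ω} {P : Measure Ω} [IsProbabilityMeasure P]

/-- The deviation of a solution from its initial datum. -/
noncomputable def deviation (u : ℝ≥0 → Ω → L2 d) (u₀ : Ω → L2 d) (z : ℝ≥0 × Ω) : L2 d := u z.1 z.2 - u₀ z.2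

lemma memLp_solution {𝓕 : Filtration ℝ≥0 mΩ} {W : ℝ≥0 → Ω → ℝ} {F : ℝ → Space d}
    {σ : Space d → ℝ → ℝ} {u₀ : Ω → L2 d} {u : ℝ≥0 → Ω → L2 d}
    (hu : IsStochasticEntropySolution 𝓕 P W F σ u₀ u) :
    ∃ D : ℝ≥0, ∀ h, 0 < h → h ≤ 1 →
      MemLp (fun z : ℝ≥0 × Ω ↦ u z.1 z.2) 2 ((weightedTime h).prod P) ∧
      eLpNorm (fun z : ℝ≥0 × Ω ↦ u z.1 z.2) 2 ((weightedTime h).prod P) ≤ D := by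
  have hum := stronglyMeasurable_uncurry_of_predictable hu.predictable
  obtain ⟨M, hM⟩ := exists_moment_bound (hu.moments 1 one_pos 2 le_rfl)
  refine ⟨NNReal.sqrt M, fun h hh h1 ↦ ?_⟩
  have := isProbabilityMeasure_weightedTime hh
  have hae : ∀ᵐ t ∂weightedTime h, t ≤ 1 :=
    (ae_weightedTime_mem h).mono fun t ht ↦ ht.2.trans h1
  refine ⟨memLp_uncurry hum hM hae, ?_⟩
  have h2 := lintegral_powerMoment_le hum hM hae
  simp only [powerMoment_two, measure_univ, mul_one] at h2
  rw [eLpNorm_eq_lintegral_rpow_enorm_toReal (by simp) (by simp)]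
  simp only [ENNReal.toReal_ofNat, ENNReal.rpow_ofNat]
  refine (ENNReal.rpow_le_rpow h2 (by norm_num)).trans ?_
  rw [NNReal.sqrt_eq_rpow, ENNReal.coe_rpow_of_nonneg _ (by norm_num)]

lemma memLp_deviation {𝓕 : Filtration ℝ≥0 mΩ} {W : ℝ≥0 → Ω → ℝ} {F : ℝ → Space d}
    {σ : Space d → ℝ → ℝ} {u₀ : Ω → L2 d} (hu₀ : InitialAssumption 𝓕 P u₀)
    {u : ℝ≥0 → Ω → L2 d} (hu : IsStochasticEntropySolution 𝓕 P W F σ u₀ u) :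
    ∃ D : ℝ≥0, ∀ h, 0 < h → h ≤ 1 → MemLp (deviation u u₀) 2 ((weightedTime h).prod P) ∧
      eLpNorm (deviation u u₀) 2 ((weightedTime h).prod P) ≤ D := by
  obtain ⟨D, hD⟩ := memLp_solution hu
  have h₀ := memLp_initial hu₀
  refine ⟨D + (eLpNorm u₀ 2 P).toNNReal, fun h hh h1 ↦ ?_⟩
  have := isProbabilityMeasure_weightedTime hh
  have h₀' := memLp_comp_snd h₀ hh
  have e : eLpNorm (fun z : ℝ≥0 × Ω ↦ u₀ z.2) 2 ((weightedTime h).prod P) = eLpNorm u₀ 2 P :=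
    eLpNorm_comp_measurePreserving h₀.1 measurePreserving_snd
  refine ⟨(hD h hh h1).1.sub h₀', ?_⟩
  refine (eLpNorm_sub_le (hD h hh h1).1.1 h₀'.1 (by norm_num)).trans ?_
  rw [e, ENNReal.coe_add, ENNReal.coe_toNNReal h₀.2.ne]
  gcongr
  exact (hD h hh h1).2

variable {𝓕 : Filtration ℝ≥0 mΩ} {W : ℝ≥0 → Ω → ℝ} {F : ℝ → Space d} {σ : Space d → ℝ → ℝ}
  {u₀ : Ω → L2 d} {u : ℝ≥0 → Ω → L2 d} {φ : Space d → ℝ}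

/-- The quadratic entropy increases on average by at most `O(h)` over the time `h`. -/
lemma exists_averaged_entropy_increment_bound (hW : IsFilteredBrownian 𝓕 P W)
    (hF : FluxAssumption F) (hσ : NoiseAssumption σ) (hu₀ : InitialAssumption 𝓕 P u₀)
    (hu : IsStochasticEntropySolution 𝓕 P W F σ u₀ u) (hφ : ContDiff ℝ 2 φ)
    (hφc : HasCompactSupport φ) (hφ0 : ∀ x, 0 ≤ φ x) (a : ℝ) {A : Set Ω}
    (hA : MeasurableSet[𝓕 0] A) :
    ∃ C : ℝ, ∀ h : ℝ≥0, 0 < h → h ≤ 1 →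
      ∫ z, A.indicator 1 z.2 * (quadEntropy φ a (u z.1 z.2) - quadEntropy φ a (u₀ z.2))
        ∂(weightedTime h).prod P ≤ C * h := by
  have hχ : StronglyMeasurable[𝓕 0] (A.indicator (1 : Ω → ℝ)) :=
    stronglyMeasurable_one.indicator hA
  have hχ0 (ω : Ω) : 0 ≤ A.indicator (1 : Ω → ℝ) ω := indicator_nonneg (by simp) ω
  have hχ1 (ω : Ω) : A.indicator (1 : Ω → ℝ) ω ≤ 1 := indicator_le_self' (by simp) ω
  obtain ⟨C, hC⟩ := exists_averaged_entropy_bound hW hF hσ hu₀ hu hφ hφc hφ0 a hχ hχ0 hχ1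
  obtain ⟨D, hD⟩ := memLp_solution hu
  refine ⟨C, fun h hh h1 ↦ ?_⟩
  have := isProbabilityMeasure_weightedTime hh
  have hχm : AEStronglyMeasurable (fun z : ℝ≥0 × Ω ↦ A.indicator (1 : Ω → ℝ) z.2)
      ((weightedTime h).prod P) :=
    ((hχ.mono (𝓕.le 0)).comp_measurable measurable_snd).aestronglyMeasurable
  have hχb (ω : Ω) : ‖A.indicator (1 : Ω → ℝ) ω‖ ≤ 1 := by
    rw [Real.norm_of_nonneg (hχ0 ω)]; exact hχ1 ω
  have i₁ := (integrable_quadEntropy (hD h hh h1).1 hφ.continuous hφc a).bdd_mul hχm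
    (ae_of_all _ fun z ↦ hχb z.2)
  have i₂ := (integrable_quadEntropy (memLp_comp_snd (memLp_initial hu₀) hh)
    hφ.continuous hφc a).bdd_mul hχm (ae_of_all _ fun z ↦ hχb z.2)
  simp only [mul_sub]
  rw [integral_sub i₁ i₂, integral_fun_snd fun ω ↦ A.indicator (1 : Ω → ℝ) ω * quadEntropy φ a (u₀ ω)]
  simp only [probReal_univ, one_smul]
  linarith [hC h hh h1]

lemma tendsto_avgPairing_test (hW : IsFilteredBrownian 𝓕 P W)
    (hF : FluxAssumption F) (hσ : NoiseAssumption σ) (hu₀ : InitialAssumption 𝓕 P u₀)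
    (hu : IsStochasticEntropySolution 𝓕 P W F σ u₀ u) (hφ : ContDiff ℝ 2 φ)
    (hφc : HasCompactSupport φ) (hφ0 : ∀ x, 0 ≤ φ x) {A : Set Ω} (hA : MeasurableSet[𝓕 0] A) :
    Tendsto (avgPairing P (deviation u u₀)
      (A.indicator fun _ ↦ toL2 φ hφ.continuous hφc)) (𝓝[>] 0) (𝓝 0) := by
  have hφm := hφ.continuous
  obtain ⟨D, hD⟩ := memLp_solution hu
  obtain ⟨D', hD'⟩ := memLp_deviation hu₀ hu
  have h₀ := memLp_initial hu₀
  have hχ0 (ω : Ω) : 0 ≤ A.indicator (1 : Ω → ℝ) ω := indicator_nonneg (by simp) ω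
  have hχm : StronglyMeasurable (A.indicator (1 : Ω → ℝ)) :=
    stronglyMeasurable_one.indicator (𝓕.le 0 A hA)
  have hχb (ω : Ω) : ‖A.indicator (1 : Ω → ℝ) ω‖ ≤ 1 := by
    rw [Real.norm_of_nonneg (hχ0 ω)]; exact indicator_le_self' (by simp) ω
  have hint {h : ℝ≥0} {f : ℝ≥0 × Ω → ℝ} (hf : Integrable f ((weightedTime h).prod P)) :
      Integrable (fun z ↦ A.indicator 1 z.2 * f z) ((weightedTime h).prod P) :=
    hf.bdd_mul (hχm.comp_measurable measurable_snd).aestronglyMeasurable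
      (ae_of_all _ fun z ↦ hχb z.2)
  have hX (h : ℝ≥0) : avgPairing P (deviation u u₀)
      (A.indicator fun _ ↦ toL2 φ hφm hφc) h
      = ∫ z, A.indicator 1 z.2 * inner ℝ (deviation u u₀ z) (toL2 φ hφm hφc)
        ∂(weightedTime h).prod P := by
    refine integral_congr_ae (ae_of_all _ fun z ↦ ?_)
    by_cases hz : z.2 ∈ A <;> simp [hz]
  -- Since the entropy of `u` is nonnegative, `Y` is at least minus the expected entropy of `u₀`,
  -- whatever `a` is.
  refine tendsto_zero_of_quadratic_bound (D := ∫ ω, quadEntropy φ 0 (u₀ ω) ∂P)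
    (Y := fun h ↦ ∫ z, A.indicator 1 z.2 * (quadEntropy φ 0 (u z.1 z.2) - quadEntropy φ 0 (u₀ z.2))
      ∂(weightedTime h).prod P) ?_ fun a ↦ ?_
  · refine eventually_short fun h hh h1 ↦ ?_
    have := isProbabilityMeasure_weightedTime hh
    have i₁ := integrable_quadEntropy (hD h hh h1).1 hφm hφc 0
    have i₂ := integrable_quadEntropy (memLp_comp_snd h₀ hh) hφm hφc 0
    have e : -∫ ω, quadEntropy φ 0 (u₀ ω) ∂P
        = ∫ z : ℝ≥0 × Ω, -quadEntropy φ 0 (u₀ z.2) ∂(weightedTime h).prod P := by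
      rw [integral_neg, integral_fun_snd fun ω ↦ quadEntropy φ 0 (u₀ ω)]
      simp
    rw [e]
    refine integral_mono i₂.neg (hint (i₁.sub i₂)) fun z ↦ ?_
    have q₁ := quadEntropy_nonneg hφ0 0 (u z.1 z.2)
    have q₂ := quadEntropy_nonneg hφ0 0 (u₀ z.2)
    by_cases hz : z.2 ∈ A
    · simp [hz, q₁]
    · simp [hz, q₂]
  · obtain ⟨C, hC⟩ := exists_averaged_entropy_increment_bound hW hF hσ hu₀ hu hφ hφc hφ0 a hA
    refine ⟨C, eventually_short fun h hh h1 ↦ ?_⟩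
    have := isProbabilityMeasure_weightedTime hh
    have i₁ := integrable_quadEntropy (hD h hh h1).1 hφm hφc 0
    have i₂ := integrable_quadEntropy (memLp_comp_snd h₀ hh) hφm hφc 0
    have i₃ := integrable_inner_of_memLp (hD' h hh h1).1 (memLp_const (toL2 φ hφm hφc))
    have i₄ : Integrable (fun z ↦ A.indicator 1 z.2
        * (quadEntropy φ 0 (u z.1 z.2) - quadEntropy φ 0 (u₀ z.2))) ((weightedTime h).prod P) :=
      hint (i₁.sub i₂)
    rw [hX, ← integral_const_mul, ← integral_sub i₄ ((hint i₃).const_mul _)]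
    refine le_of_eq_of_le (integral_congr_ae (ae_of_all _ fun z ↦ ?_)) (hC h hh h1)
    -- The terms `a ^ 2 * ∫ φ` cancel, leaving the increment at `a = 0` minus `2 a` times the linear
    -- pairing.
    simp only [quadEntropy_eq hφm hφc, deviation, inner_sub_left]
    ring

/-- Weak convergence to the initial datum. -/
lemma tendsto_avgPairing_deviation (hW : IsFilteredBrownian 𝓕 P W)
    (hF : FluxAssumption F) (hσ : NoiseAssumption σ) (hu₀ : InitialAssumption 𝓕 P u₀)
    (hu : IsStochasticEntropySolution 𝓕 P W F σ u₀ u) {g : Ω → L2 d} (hg : MemLp g 2 P)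
    (hgm : StronglyMeasurable[𝓕 0] g) :
    Tendsto (avgPairing P (deviation u u₀) g) (𝓝[>] 0) (𝓝 0) := by
  obtain ⟨D, hD⟩ := memLp_deviation hu₀ hu
  refine tendsto_avgPairing_of_dense hD (𝓕.le 0)
    (Lp.dense_hasCompactSupport_contDiff (by simp)) ?_ hg hgm
  rintro c ⟨φ, hcφ, hφc, hφ⟩ A hA
  -- The dense class contains signed functions, whereas the entropy inequality accepts only
  -- nonnegative ones.
  obtain ⟨f₁, f₂, h₁, hc₁, hn₁, h₂, hc₂, hn₂, hf⟩ :=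
    exists_nonneg_sub (hφ.of_le (by norm_cast)) hφc
  have t₁ := tendsto_avgPairing_test hW hF hσ hu₀ hu h₁ hc₁ hn₁ hA
  have t₂ := tendsto_avgPairing_test hW hF hσ hu₀ hu h₂ hc₂ hn₂ hA
  set c₁ := toL2 f₁ h₁.continuous hc₁
  set c₂ := toL2 f₂ h₂.continuous hc₂
  have hcc : c + c₂ = c₁ := by
    refine Lp.ext ?_
    filter_upwards [Lp.coeFn_add c c₂, hcφ, toL2_coe f₁ h₁.continuous hc₁,
      toL2_coe f₂ h₂.continuous hc₂] with x e e₀ e₁ e₂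
    rw [e, Pi.add_apply, e₀, e₁, e₂, hf]
    ring
  have t := t₁.sub t₂
  rw [sub_zero] at t
  refine t.congr' ?_
  have hind (b : L2 d) : MemLp (A.indicator fun _ ↦ b) 2 P :=
    (memLp_const b).indicator (𝓕.le 0 A hA)
  filter_upwards [eventually_short fun h hh h1 ↦ And.intro hh (hD h hh h1)] with h h2
  have := avgPairing_add h2.1 h2.2.1 (hind c) (hind c₂)
  rw [← indicator_add'] at this
  change avgPairing P (deviation u u₀) (A.indicator fun _ ↦ c + c₂) h = _ at this
  rw [hcc] at this
  linarith

/-- Strong convergence to the initial datum in weighted `L²`. -/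
lemma tendsto_quadEntropy_deviation (hW : IsFilteredBrownian 𝓕 P W)
    (hF : FluxAssumption F) (hσ : NoiseAssumption σ) (hu₀ : InitialAssumption 𝓕 P u₀)
    (hu : IsStochasticEntropySolution 𝓕 P W F σ u₀ u) (hφ : ContDiff ℝ 2 φ)
    (hφc : HasCompactSupport φ) (hφ0 : ∀ x, 0 ≤ φ x) :
    Tendsto (fun h ↦ ∫ z, quadEntropy φ 0 (deviation u u₀ z) ∂(weightedTime h).prod P)
      (𝓝[>] 0) (𝓝 0) := by
  have hφm := hφ.continuous
  obtain ⟨D, hD⟩ := memLp_solution hu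
  obtain ⟨D', hD'⟩ := memLp_deviation hu₀ hu
  have h₀ := memLp_initial hu₀
  have hM : MemLp (fun ω ↦ mulL φ hφm hφc (u₀ ω)) 2 P := (mulL φ hφm hφc).comp_memLp' h₀
  have hL := tendsto_avgPairing_deviation hW hF hσ hu₀ hu hM
    ((mulL φ hφm hφc).continuous.comp_stronglyMeasurable hu₀.measurable)
  obtain ⟨C, hC⟩ := exists_averaged_entropy_increment_bound hW hF hσ hu₀ hu hφ hφc hφ0 0
    (A := univ) MeasurableSet.univ
  have hlin : Tendsto (fun h : ℝ≥0 ↦ C * (h : ℝ)) (𝓝[>] 0) (𝓝 (C * ((0 : ℝ≥0) : ℝ))) :=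
    ((by fun_prop : Continuous fun h : ℝ≥0 ↦ C * (h : ℝ)).tendsto 0).mono_left nhdsWithin_le_nhds
  have hlim := hlin.sub (hL.const_mul 2)
  simp only [NNReal.coe_zero, mul_zero, sub_zero] at hlim
  refine tendsto_of_tendsto_of_tendsto_of_le_of_le' tendsto_const_nhds hlim
    (Eventually.of_forall fun h ↦ integral_nonneg fun z ↦ quadEntropy_nonneg hφ0 _ _)
    (eventually_short fun h hh h1 ↦ ?_)
  have := isProbabilityMeasure_weightedTime hh
  have i₁ := integrable_quadEntropy (hD h hh h1).1 hφm hφc 0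
  have i₂ := integrable_quadEntropy (memLp_comp_snd h₀ hh) hφm hφc 0
  have i₃ := integrable_inner_of_memLp (hD' h hh h1).1 (memLp_comp_snd hM hh)
  have hCh := hC h hh h1
  simp only [indicator_univ, Pi.one_apply, one_mul] at hCh
  have e : ∫ z, quadEntropy φ 0 (deviation u u₀ z) ∂(weightedTime h).prod P
      = ∫ z, (quadEntropy φ 0 (u z.1 z.2) - quadEntropy φ 0 (u₀ z.2)) ∂(weightedTime h).prod P
        - 2 * avgPairing P (deviation u u₀) (fun ω ↦ mulL φ hφm hφc (u₀ ω)) h := by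
    have i₄ : Integrable (fun z : ℝ≥0 × Ω ↦ quadEntropy φ 0 (u z.1 z.2) - quadEntropy φ 0 (u₀ z.2))
      ((weightedTime h).prod P) := i₁.sub i₂
    rw [avgPairing, ← integral_const_mul, ← integral_sub i₄ (i₃.const_mul 2)]
    exact integral_congr_ae (ae_of_all _ fun z ↦ quadEntropy_zero_sub hφm hφc _ _)
  rw [e]
  linarith

/-! ### From weighted `L²` to weighted `L¹` -/

lemma lintegral_enorm_mul_le (hφ : Continuous φ) (hφc : HasCompactSupport φ)
    (hφ0 : ∀ x, 0 ≤ φ x) {δ : ℝ} (hδ : 0 < δ) (v w : L2 d) :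
    ∫⁻ x in tsupport φ, ‖v x - w x‖ₑ * ENNReal.ofReal (φ x)
      ≤ ENNReal.ofReal (δ * (∫ x, φ x) + (4 * δ)⁻¹ * quadEntropy φ 0 (v - w)) := by
  have i₁ : Integrable fun x ↦ δ * φ x :=
    (hφ.integrable_of_hasCompactSupport hφc).const_mul δ
  have i₂ := (integrable_sq_mul hφ hφc (v - w)).const_mul (4 * δ)⁻¹
  have e : δ * (∫ x, φ x) + (4 * δ)⁻¹ * quadEntropy φ 0 (v - w)
      = ∫ x, (δ * φ x + (4 * δ)⁻¹ * ((v - w : L2 d) x ^ 2 * φ x)) := by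
    rw [integral_add i₁ i₂, integral_const_mul, integral_const_mul]
    simp [quadEntropy]
  have i₃ : Integrable fun x ↦ δ * φ x + (4 * δ)⁻¹ * ((v - w : L2 d) x ^ 2 * φ x) := i₁.add i₂
  rw [e, ofReal_integral_eq_lintegral_ofReal i₃ (ae_of_all _ fun x ↦ by
    have := hφ0 x
    simp only [Pi.zero_apply]; positivity)]
  refine (setLIntegral_le_lintegral _ _).trans (lintegral_mono_ae ?_)
  filter_upwards [Lp.coeFn_sub v w] with x hx
  rw [← ofReal_norm, ← ENNReal.ofReal_mul (norm_nonneg _)]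
  refine ENNReal.ofReal_le_ofReal ?_
  rw [hx, Pi.sub_apply, Real.norm_eq_abs, ← sq_abs (v x - w x)]
  set r := |v x - w x|
  -- Young's inequality; the compact support of `φ` makes the constant `δ` integrable against it.
  have hr : r ≤ δ + (4 * δ)⁻¹ * r ^ 2 := by
    have : δ + (4 * δ)⁻¹ * r ^ 2 - r = (4 * δ)⁻¹ * (r - 2 * δ) ^ 2 := by field_simp; ring
    have h2 : 0 ≤ (4 * δ)⁻¹ * (r - 2 * δ) ^ 2 := by positivity
    linarith
  calc r * φ x ≤ (δ + (4 * δ)⁻¹ * r ^ 2) * φ x := mul_le_mul_of_nonneg_right hr (hφ0 x)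
    _ = _ := by ring

/-- Strong convergence to the initial datum in weighted `L¹`. -/
theorem tendsto_average_enorm_deviation (hW : IsFilteredBrownian 𝓕 P W)
    (hF : FluxAssumption F) (hσ : NoiseAssumption σ) (hu₀ : InitialAssumption 𝓕 P u₀)
    (hu : IsStochasticEntropySolution 𝓕 P W F σ u₀ u) (hφ : ContDiff ℝ 2 φ)
    (hφc : HasCompactSupport φ) (hφ0 : ∀ x, 0 ≤ φ x) :
    Tendsto
      (fun h : ℝ≥0 ↦ ∫⁻ ω, (h : ℝ≥0∞)⁻¹ *
        (∫⁻ t, (∫⁻ x in tsupport φ, ‖u t ω x - u₀ ω x‖ₑ * ENNReal.ofReal (φ x))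
          ∂timeMeasure h) ∂P)
      (𝓝[>] 0) (𝓝 0) := by
  have hφm := hφ.continuous
  obtain ⟨D, hD⟩ := memLp_deviation hu₀ hu
  have hlim := tendsto_quadEntropy_deviation hW hF hσ hu₀ hu hφ hφc hφ0
  -- The uniform average over `(0, h]` is controlled by the weighted average over `(0, 2 h]`, so the
  -- `L²` limit is used at `2 * h`.
  have hdouble : Tendsto (fun h : ℝ≥0 ↦ 2 * h) (𝓝[>] 0) (𝓝[>] 0) := by
    refine tendsto_nhdsWithin_iff.2 ⟨?_, ?_⟩
    · have : Tendsto (fun h : ℝ≥0 ↦ 2 * h) (𝓝 0) (𝓝 (2 * 0)) :=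
        (by fun_prop : Continuous fun h : ℝ≥0 ↦ 2 * h).tendsto 0
      rw [mul_zero] at this
      exact this.mono_left nhdsWithin_le_nhds
    · filter_upwards [self_mem_nhdsWithin] with h hh
      exact mul_pos two_pos (mem_Ioi.1 hh)
  have hdev : StronglyMeasurable (deviation u u₀) :=
    (stronglyMeasurable_uncurry_of_predictable hu.predictable).sub
      ((hu₀.measurable.mono (𝓕.le 0)).comp_measurable measurable_snd)
  set c := ∫ x, φ x
  have hc0 : 0 ≤ c := integral_nonneg hφ0
  rw [ENNReal.tendsto_nhds_zero]
  intro ε hε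
  obtain ⟨e, he, heε⟩ : ∃ e : ℝ, 0 < e ∧ ENNReal.ofReal e ≤ ε := by
    obtain ⟨r, hr0, hr⟩ := ENNReal.lt_iff_exists_nnreal_btwn.1 hε
    exact ⟨r, by exact_mod_cast hr0, by simpa using hr.le⟩
  -- The final bound is `2 (δ c + (4 δ)⁻¹ q)` with `q < δ e`: the first part is at most `e / 2` by
  -- this choice of `δ`, the second by that of `q`. The `+ 1` covers `c = 0`.
  set δ := e / (4 * (c + 1))
  have hδ : 0 < δ := by positivity
  have hδc : δ * (c + 1) = e / 4 := by simp only [δ]; field_simp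
  filter_upwards [self_mem_nhdsWithin, hdouble.eventually (hlim.eventually_lt_const
    (by positivity : 0 < δ * e)), hdouble.eventually (eventually_short hD)] with h hh hsmall hDh
  have hh0 : 0 < h := hh
  have hh2 : 0 < 2 * h := mul_pos two_pos hh0
  have := isProbabilityMeasure_weightedTime hh2
  have iQ := integrable_quadEntropy hDh.1 hφm hφc 0
  let B : ℝ≥0 × Ω → ℝ := fun z ↦ δ * c + (4 * δ)⁻¹ * quadEntropy φ 0 (deviation u u₀ z)
  have hBm : Measurable fun z ↦ ENNReal.ofReal (B z) :=
    ((((continuous_quadEntropy hφm hφc 0).comp_stronglyMeasurable hdev).measurable.const_mul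
      _).const_add _).ennreal_ofReal
  have hBi : Integrable B ((weightedTime (2 * h)).prod P) :=
    (integrable_const _).add (iQ.const_mul _)
  have hB0 (z : ℝ≥0 × Ω) : 0 ≤ B z := by
    have := quadEntropy_nonneg hφ0 0 (deviation u u₀ z)
    positivity
  calc ∫⁻ ω, (h : ℝ≥0∞)⁻¹ *
        (∫⁻ t, (∫⁻ x in tsupport φ, ‖u t ω x - u₀ ω x‖ₑ * ENNReal.ofReal (φ x))
          ∂timeMeasure h) ∂P
      ≤ ∫⁻ ω, 2 * ∫⁻ t, ENNReal.ofReal (B (t, ω)) ∂weightedTime (2 * h) ∂P := by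
        refine lintegral_mono fun ω ↦ le_trans ?_ (inv_mul_lintegral_timeMeasure_le hh0
          (hBm.comp measurable_prodMk_right))
        gcongr with t
        exact lintegral_enorm_mul_le hφm hφc hφ0 hδ (u t ω) (u₀ ω)
    _ = 2 * ∫⁻ z, ENNReal.ofReal (B z) ∂(weightedTime (2 * h)).prod P := by
        rw [lintegral_const_mul _ hBm.lintegral_prod_left', lintegral_prod_symm _ hBm.aemeasurable]
    _ = ENNReal.ofReal (2 * (δ * c + (4 * δ)⁻¹ *
          ∫ z, quadEntropy φ 0 (deviation u u₀ z) ∂(weightedTime (2 * h)).prod P)) := by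
        rw [← ofReal_integral_eq_lintegral_ofReal hBi (ae_of_all _ hB0),
          ENNReal.ofReal_mul zero_le_two, ENNReal.ofReal_ofNat,
          integral_add (integrable_const _) (iQ.const_mul _)]
        simp [integral_const_mul]
    _ ≤ ENNReal.ofReal e := by
        refine ENNReal.ofReal_le_ofReal ?_
        calc _ ≤ 2 * (δ * c + (4 * δ)⁻¹ * (δ * e)) := by gcongr
          _ = 2 * (δ * c) + e / 2 := by field_simp; ring
          _ ≤ e := by nlinarith
    _ ≤ ε := heε

end StrongLimit

end StochConsLaw

theorem lemma2p1 {Ω : Type*} {mΩ : MeasurableSpace Ω} (P : Measure Ω) [IsProbabilityMeasure P]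
    (𝓕 : Filtration ℝ≥0 mΩ) (h𝓕 : StochConsLaw.UsualHypotheses 𝓕 P)
    (W : ℝ≥0 → Ω → ℝ) (hW : StochConsLaw.IsFilteredBrownian 𝓕 P W)
    {d : ℕ} (F : ℝ → StochConsLaw.Space d) (hF : StochConsLaw.FluxAssumption F)
    (σ : StochConsLaw.Space d → ℝ → ℝ) (hσ : StochConsLaw.NoiseAssumption σ)
    (u₀ : Ω → StochConsLaw.L2 d) (hu₀ : StochConsLaw.InitialAssumption 𝓕 P u₀)
    (u : ℝ≥0 → Ω → StochConsLaw.L2 d)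
    (hu : StochConsLaw.IsStochasticEntropySolution 𝓕 P W F σ u₀ u)
    (ψ : StochConsLaw.Space d → ℝ) (hψ : ContDiff ℝ 2 ψ) (hψc : HasCompactSupport ψ)
    (hψ0 : ∀ x, 0 ≤ ψ x) :
    Tendsto
      (fun h : ℝ≥0 ↦ ∫⁻ ω, (h : ℝ≥0∞)⁻¹ *
        (∫⁻ t, (∫⁻ x in tsupport ψ, ‖u t ω x - u₀ ω x‖ₑ * ENNReal.ofReal (ψ x))
          ∂StochConsLaw.timeMeasure h) ∂P)
      (𝓝[>] 0) (𝓝 0) :=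
  StochConsLaw.tendsto_average_enorm_deviation hW hF hσ hu₀ hu hψ hψc hψ0
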